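/- A dessin is a finite connected bicolored graph (every edge joins a black vertex to a white vertex) equipped with a cyclic ordering of the edges around each vertex; a dessin is a tree if its graph is a tree. Let $\sigma_0$ (resp. $\sigma_1$) be the permutation of the edges sending each edge to the next one around its black (resp. white) endpoint. The monodromy group of the dessin is the permutation group $\langle\sigma_0,\sigma_1,\sigma_\infty\rangle$, where $\sigma_0\sigma_1\sigma_\infty=1$. Its passport $[b_1,\dots,b_k;w_1,\dots,w_\ell]$ consists of the list of degrees of the black vertices and the list of degrees of the white vertices (up to order; $a^k$ stands for $k$ entries equal to $a$). An isomorphism of dessins is a color-preserving graph isomorphism respecting the cyclic orderings. $\mathbb Z_k$ is the cyclic group of order $k$, and $H\wr\mathbb Z_d=H^d\rtimes\mathbb Z_d$, with $\mathbb Z_d$ permuting the $d$ factors cyclically. Let $r>1$, $s\ge 1$, $t\ge 1$ be integers, $n=(r-1)s+t$ and $d=\gcd(s,t)$. Then, up to isomorphism, there is exactly one dessin that is a tree and has passport $[s^{r-1},t;\,r,1^{(r-1)(s-1)+(t-1)}]$. It has $n$ edges, and its monodromy group $G$ satisfies: 1. If $s=t$, then $G\cong\mathbb Z_r\wr\mathbb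 Z_s$. 2. If $s\ne t$ and $\gcd(d,n/d)=1$, then - $G\cong S_{n/d}\wr\mathbb Z_d$ if $r$ is even; - $G\cong\widetilde R_d$ if $r$ is odd and $t/d$ is even, where $\widetilde R_d$ is the subgroup of all $(\tau_1,\dots,\tau_d,g)\in S_{n/d}\wr\mathbb Z_d$ with $\mathrm{sgn}(\tau_1)=\cdots=\mathrm{sgn}(\tau_d)$, and this subgroup has index $2^{d-1}$ in $S_{n/d}\wr\mathbb Z_d$; - $G\cong A_{n/d}\wr\mathbb Z_d$ if $r$ and $t/d$ are both odd. (Nothing is asserted when $s\neq t$ and $\gcd(d,n/d)\neq 1$.) -/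

import Mathlib

/-- The simple graph on the vertices of a bicolored multigraph with endpoint maps `black`, `white`:
a black and a white vertex are adjacent if some edge joins them (`fromRel` symmetrizes). -/
def bicoloredGraph {B W E : Type} (black : E → B) (white : E → W) : SimpleGraph (B ⊕ W) :=
  SimpleGraph.fromRel fun x y => ∃ e : E, x = Sum.inl (black e) ∧ y = Sum.inr (white e)

/-- A dessin: a finite connected bicolored graph (multiple edges allowed; every edge joins a black
vertex to a white vertex) with a cyclic ordering of the edges around each vertex. The cyclic
orderings are recorded by `σ₀` and `σ₁`, sending an edge to the next one around its black,
respectively white, endpoint: the cycles of `σ₀` (fixed points included) are exactly the sets of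
edges at the black vertices, and those of `σ₁` the sets of edges at the white vertices. -/
structure Dessin where
  /-- black vertices -/
  B : Type
  /-- white vertices -/
  W : Type
  /-- edges -/
  E : Type
  [fintypeB : Fintype B]
  [fintypeW : Fintype W]
  [fintypeE : Fintype E]
  /-- the black endpoint of an edge -/
  black : E → B
  /-- the white endpoint of an edge -/
  white : E → W
  σ₀ : Equiv.Perm E
  σ₁ : Equiv.Perm E
  sameCycle_σ₀ : ∀ e e' : E, σ₀.SameCycle e e' ↔ black e = black e'
  sameCycle_σ₁ : ∀ e e' : E, σ₁.SameCycle e e' ↔ white e = white e'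
  connected : (bicoloredGraph black white).Connected

namespace Dessin

attribute [instance] Dessin.fintypeB Dessin.fintypeW Dessin.fintypeE

/-- The underlying simple graph on the set of all vertices. -/
def graph (D : Dessin) : SimpleGraph (D.B ⊕ D.W) := bicoloredGraph D.black D.white

/-- The dessin is a tree: no two edges have the same endpoints, and the underlying simple graph is
connected and has no cycle. -/
def IsTree (D : Dessin) : Prop :=
  (∀ e e' : D.E, D.black e = D.black e' → D.white e = D.white e' → e = e') ∧ D.graph.IsTree

/-- The number of edges at a black vertex. -/
noncomputable def blackDegree (D : Dessin) (b : D.B) : ℕ := Nat.card {e : D.E // D.black e = b}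

/-- The number of edges at a white vertex. -/
noncomputable def whiteDegree (D : Dessin) (w : D.W) : ℕ := Nat.card {e : D.E // D.white e = w}

/-- The passport: the degrees of the black vertices and the degrees of the white vertices, each
listed with multiplicity. -/
noncomputable def passport (D : Dessin) : Multiset ℕ × Multiset ℕ :=
  ((Finset.univ : Finset D.B).val.map D.blackDegree,
    (Finset.univ : Finset D.W).val.map D.whiteDegree)

/-- The permutation `σ_∞` with `σ₀ σ₁ σ_∞ = 1`. -/
def σInf (D : Dessin) : Equiv.Perm D.E := (D.σ₀ * D.σ₁)⁻¹

/-- The monodromy group `⟨σ₀, σ₁, σ_∞⟩`. -/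
def monodromyGroup (D : Dessin) : Subgroup (Equiv.Perm D.E) :=
  Subgroup.closure {D.σ₀, D.σ₁, D.σInf}

/-- An isomorphism of dessins: a color-preserving isomorphism of graphs that respects the cyclic
orderings of the edges around the vertices. -/
structure Iso (D D' : Dessin) where
  onB : D.B ≃ D'.B
  onW : D.W ≃ D'.W
  onE : D.E ≃ D'.E
  black_comm : ∀ e, D'.black (onE e) = onB (D.black e)
  white_comm : ∀ e, D'.white (onE e) = onW (D.white e)
  σ₀_comm : ∀ e, D'.σ₀ (onE e) = onE (D.σ₀ e)
  σ₁_comm : ∀ e, D'.σ₁ (onE e) = onE (D.σ₁ e)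

end Dessin

/-- The cyclic group `ℤ_k` (of order `k` for `k ≥ 1`), written multiplicatively. -/
abbrev CyclicGp (k : ℕ) : Type := Multiplicative (ZMod k)

/-- The subgroup `R̃_d` of `S_m ≀ ℤ_d` of all `(τ₁, …, τ_d, g)` with `sgn τ₁ = ⋯ = sgn τ_d`. The
wreath product is `S_m ^ d ⋊ ℤ_d` with `ℤ_d` permuting the `d` coordinates regularly (cyclically). -/
def RTilde (m d : ℕ) : Subgroup (Equiv.Perm (Fin m) ≀ᵣ CyclicGp d) where
  carrier := {x | ∀ i j : CyclicGp d, Equiv.Perm.sign (x.left i) = Equiv.Perm.sign (x.left j)}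
  one_mem' := by
    intro i j
    simp
  mul_mem' := by
    intro a b ha hb i j
    simp only [Set.mem_ofPred_eq, RegularWreathProduct.mul_left, Pi.mul_apply, map_mul] at *
    rw [ha i j, hb _ (a.right⁻¹ * j)]
  inv_mem' := by
    intro a ha i j
    simp only [Set.mem_ofPred_eq, RegularWreathProduct.inv_left, Pi.inv_apply, map_inv] at *
    rw [ha _ (a.right * j)]

/-! A tree with this passport is a star. It has `r` black vertices, and the white vertex of degree
`r`, having no double edges, meets each of them exactly once; all other white vertices are leaves.
Hence the pair of rotations satisfies `IsStar` (`Dessin.exists_isStar`). This relation determines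
the pair up to simultaneous conjugation (`IsStar.exists_equiv`), which gives uniqueness and allows
the group to be computed in any convenient model.

Write `s = d s'`, `t = d t'` with `s'`, `t'` coprime. If `ρ`, `c` in a group `D` acting on `X` form
a star with degrees `s'`, `t'`, then in the action of `D ≀ᵣ ℤ_d` on `X × ℤ_d` the elements `shift d
ρ` and `factor d c` form a star with degrees `s`, `t` (`IsStar.toPerm_wreath`). So the monodromy
group is the subgroup they generate. The part of it living in one coordinate, `factorSubgroup`,
contains `c` and is normalized by `ρ`, because `shift d ρ ^ d` is the diagonal `ρ`.

If `s = t`, then `D = ℤ_r`, `ρ = 1` and `c` is a generator, so everything is generated. If `s ≠ t`,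
then `⟨ρ, c⟩` is primitive on `n/d` points, and a commutator built from `c` and conjugates by powers
of `ρ` is a three-cycle. Jordan's theorem and conjugation then put the alternating group inside
`factorSubgroup` (`IsStar.alternatingGroup_le`). Only signs remain: `c` is an `r`-cycle, and for odd
`r` the sign of `ρ` is `(-1)^(t'-1)`. For `r` even, `c` is odd and the full wreath product appears;
for `r`, `t'` odd one works inside the alternating group; for `r` odd and `t'` even, `d` is odd, and
a conjugation equalizes the signs of the coordinates. -/

/-- The degree of the `i`-th black vertex of the star: `t` for the special one, `s` for others. -/
def starDegree (s t : ℕ) {r : ℕ} (i : ZMod r) : ℕ := if i = 0 then t else s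

/-- The combinatorics of the star tree: `σ₁` permutes the edges `x i` at the central white vertex
cyclically and fixes all other edges, and each edge lies in the `σ₀`-cycle of exactly one `x i`,
which has length `starDegree s t i`. -/
structure IsStar {E : Type*} {r : ℕ} (s t : ℕ) (σ₀ σ₁ : Equiv.Perm E) (x : ZMod r → E) :
    Prop where
  apply_center : ∀ i, σ₁ (x i) = x (i + 1)
  apply_of_ne : ∀ e, (∀ i, e ≠ x i) → σ₁ e = e
  exists_zpow : ∀ e, ∃ i, ∃ k : ℤ, (σ₀ ^ k) (x i) = e
  zpow_eq_iff : ∀ i j, ∀ k : ℤ, (σ₀ ^ k) (x i) = x j ↔ i = j ∧ (starDegree s t i : ℤ) ∣ k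

/-! ### Rigidity of stars -/

namespace IsStar

section basic

variable {E E' : Type*} {r s t : ℕ} {σ₀ σ₁ : Equiv.Perm E} {x : ZMod r → E}
  {σ₀' σ₁' : Equiv.Perm E'} {x' : ZMod r → E'}

theorem zpow_eq_zpow_iff (h : IsStar s t σ₀ σ₁ x) (i j : ZMod r) (k l : ℤ) :
    (σ₀ ^ k) (x i) = (σ₀ ^ l) (x j) ↔ i = j ∧ (starDegree s t i : ℤ) ∣ k - l := by
  rw [← h.zpow_eq_iff, sub_eq_neg_add, zpow_add, Equiv.Perm.mul_apply, zpow_neg,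
    Equiv.Perm.inv_eq_iff_eq]

theorem injective (h : IsStar s t σ₀ σ₁ x) : Function.Injective x := fun i j hij =>
  ((h.zpow_eq_iff i j 0).1 (by simpa using hij)).1

/-- The map between two stars with the same parameters. -/
noncomputable def toFun (h : IsStar s t σ₀ σ₁ x) (σ₀' : Equiv.Perm E') (x' : ZMod r → E')
    (e : E) : E' :=
  (σ₀' ^ (h.exists_zpow e).choose_spec.choose) (x' (h.exists_zpow e).choose)

/-- The chosen `i` and exponent are irrelevant: `i` is unique, and exponents matter only modulo
`starDegree s t i`, which is the same in both stars. -/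
theorem toFun_zpow (h : IsStar s t σ₀ σ₁ x) (h' : IsStar s t σ₀' σ₁' x') (i : ZMod r) (k : ℤ) :
    h.toFun σ₀' x' ((σ₀ ^ k) (x i)) = (σ₀' ^ k) (x' i) := by
  rw [toFun, h'.zpow_eq_zpow_iff, ← h.zpow_eq_zpow_iff]
  exact (h.exists_zpow _).choose_spec.choose_spec

/-- Two stars with the same parameters are equivalent. -/
theorem exists_equiv (h : IsStar s t σ₀ σ₁ x) (h' : IsStar s t σ₀' σ₁' x') :
    ∃ f : E ≃ E', (∀ e, σ₀' (f e) = f (σ₀ e)) ∧ ∀ e, σ₁' (f e) = f (σ₁ e) := by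
  have inv' : ∀ e, h.toFun σ₀' x' (h'.toFun σ₀ x e) = e := by
    intro e
    obtain ⟨i, k, rfl⟩ := h'.exists_zpow e
    rw [h'.toFun_zpow h, h.toFun_zpow h']
  have hx : ∀ i, h.toFun σ₀' x' (x i) = x' i := fun i => by
    simpa using h.toFun_zpow h' i 0
  have hinv : ∀ e, h'.toFun σ₀ x (h.toFun σ₀' x' e) = e := by
    intro e
    obtain ⟨i, k, rfl⟩ := h.exists_zpow e
    rw [h.toFun_zpow h', h'.toFun_zpow h]
  refine ⟨⟨h.toFun σ₀' x', h'.toFun σ₀ x, hinv, inv'⟩, fun e => ?_, fun e => ?_⟩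
  · obtain ⟨i, k, rfl⟩ := h.exists_zpow e
    have := h.toFun_zpow h' i (1 + k)
    rw [zpow_add, zpow_add] at this
    simpa [h.toFun_zpow h'] using this.symm
  · show σ₁' (h.toFun σ₀' x' e) = h.toFun σ₀' x' (σ₁ e)
    by_cases he : ∃ i, e = x i
    · obtain ⟨i, rfl⟩ := he
      rw [h.apply_center, hx, hx, h'.apply_center]
    · push Not at he
      rw [h.apply_of_ne e he, h'.apply_of_ne]
      intro i hi
      rw [← hx i] at hi
      exact he i (by rw [← hinv e, hi, hinv])

theorem permCongr (h : IsStar s t σ₀ σ₁ x) (f : E ≃ E') :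
    IsStar s t (f.permCongr σ₀) (f.permCongr σ₁) (f ∘ x) := by
  have hz : ∀ k : ℤ, f.permCongr σ₀ ^ k = f.permCongr (σ₀ ^ k) := fun k =>
    (map_zpow f.permCongrHom σ₀ k).symm
  refine ⟨fun i => ?_, fun e he => ?_, fun e => ?_, fun i j k => ?_⟩
  · simp [h.apply_center]
  · rw [Equiv.permCongr_apply, h.apply_of_ne, f.apply_symm_apply]
    intro i hi
    exact he i (by simp [← hi])
  · obtain ⟨i, k, hk⟩ := h.exists_zpow (f.symm e)
    exact ⟨i, k, by simp [hz, hk]⟩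
  · rw [← h.zpow_eq_iff, hz]
    simp

theorem pow_apply_center (h : IsStar s t σ₀ σ₁ x) (i : ZMod r) (k : ℕ) :
    (σ₁ ^ k) (x i) = x (i + k) := by
  induction k with
  | zero => simp
  | succ k ih => rw [pow_succ', Equiv.Perm.mul_apply, ih, h.apply_center]; push_cast; ring_nf

theorem sameCycle_center [NeZero r] (h : IsStar s t σ₀ σ₁ x) (i j : ZMod r) :
    σ₁.SameCycle (x i) (x j) := by
  refine ⟨(j - i).val, ?_⟩
  rw [zpow_natCast, h.pow_apply_center, ZMod.natCast_zmod_val, add_sub_cancel]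

theorem sign_center [NeZero r] [Fintype E] [DecidableEq E] (h : IsStar s t σ₀ σ₁ x) (hr : 1 < r) :
    Equiv.Perm.sign σ₁ = (-1) ^ (r - 1) := by
  have : Fact (1 < r) := ⟨hr⟩
  have hne : ∀ i, σ₁ (x i) ≠ x i := fun i hi => by
    rw [h.apply_center] at hi
    simpa using h.injective hi
  have hmem : ∀ e, σ₁ e ≠ e → ∃ i, e = x i := fun e he => by
    contrapose! he
    exact h.apply_of_ne e he
  have hc : σ₁.IsCycle := by
    refine ⟨x 0, hne 0, fun e he => ?_⟩
    obtain ⟨i, rfl⟩ := hmem e he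
    exact h.sameCycle_center 0 i
  have hs : σ₁.support = Finset.univ.map ⟨x, h.injective⟩ := by
    ext e
    simp only [Equiv.Perm.mem_support, Finset.mem_map, Finset.mem_univ, true_and,
      Function.Embedding.coeFn_mk]
    refine ⟨fun he => (hmem e he).imp fun _ => Eq.symm, ?_⟩
    rintro ⟨i, rfl⟩
    exact hne i
  rw [hc.sign, hs, Finset.card_map, Finset.card_univ, ZMod.card]
  obtain ⟨m, rfl⟩ : ∃ m, r = m + 1 := ⟨r - 1, by omega⟩
  simp [pow_succ]

end basic

end IsStar

/-! ### Three-cycles and the alternating group -/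

/-- If the supports of two permutations meet in exactly one point, their commutator is a
three-cycle. -/
theorem Equiv.Perm.isThreeCycle_commutator {α : Type*} [Fintype α] [DecidableEq α]
    {f g : Equiv.Perm α} {a : α} (hf : f a ≠ a) (hg : g a ≠ a)
    (hfg : ∀ y, y ≠ a → f y = y ∨ g y = y) : (f * g * f⁻¹ * g⁻¹).IsThreeCycle := by
  have hgf : g (f a) = f a := (hfg _ hf).resolve_left fun h => hf (f.injective h)
  have hfg' : f (g a) = g a := (hfg _ hg).resolve_right fun h => hg (g.injective h)
  have hne : g a ≠ f a := fun h => hf (f.injective (by rw [← h, hfg']))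
  -- The two products can differ only at `a`, `f⁻¹ a` and `g⁻¹ a`; the swaps correct exactly these
  -- values.
  have key : f * g = (Equiv.swap a (g a) * Equiv.swap a (f a)) * (g * f) := by
    ext y
    simp only [Equiv.Perm.mul_apply]
    by_cases hy : y = a
    · subst hy
      rw [hgf, hfg', Equiv.swap_apply_right, Equiv.swap_apply_left]
    · by_cases h1 : g y = y
      · rw [h1]
        by_cases h2 : f y = a
        · rw [h2, Equiv.swap_apply_of_ne_of_ne hg hne, Equiv.swap_apply_right]
        · by_cases h3 : f y = y
          · have h4 : y ≠ f a := fun h => hy (f.injective (by rw [h3, h]))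
            have h5 : y ≠ g a := fun h => hy (g.injective (by rw [h1, h]))
            rw [h3, h1, Equiv.swap_apply_of_ne_of_ne hy h4, Equiv.swap_apply_of_ne_of_ne hy h5]
          · have h4 : g (f y) = f y := (hfg _ h2).resolve_left fun h => h3 (f.injective h)
            have h5 : f y ≠ f a := fun h => hy (f.injective h)
            have h6 : f y ≠ g a := fun h => h2 (g.injective (by rw [h4, h]))
            rw [h4, Equiv.swap_apply_of_ne_of_ne h2 h5, Equiv.swap_apply_of_ne_of_ne h2 h6]
      · have h2 : f y = y := (hfg y hy).resolve_right h1
        rw [h2]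
        by_cases h3 : g y = a
        · rw [h3, Equiv.swap_apply_left, Equiv.swap_apply_of_ne_of_ne hf hne.symm]
        · have h4 : f (g y) = g y := (hfg _ h3).resolve_right fun h => h1 (g.injective h)
          have h5 : g y ≠ g a := fun h => hy (g.injective h)
          have h6 : g y ≠ f a := fun h => h3 (f.injective (by rw [h4, h]))
          rw [h4, Equiv.swap_apply_of_ne_of_ne h3 h6, Equiv.swap_apply_of_ne_of_ne h3 h5]
  have : f * g * f⁻¹ * g⁻¹ = Equiv.swap a (g a) * Equiv.swap a (f a) := by
    rw [key]; group
  rw [this]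
  exact Equiv.Perm.isThreeCycle_swap_mul_swap_same hg.symm hf.symm hne

/-- A subgroup that is normalized by the alternating group and contains a three-cycle contains
the alternating group. -/
theorem Equiv.Perm.alternatingGroup_le_of_isThreeCycle_mem {α : Type*} [Fintype α]
    [DecidableEq α] {P : Subgroup (Equiv.Perm α)}
    (hP : ∀ g ∈ alternatingGroup α, ∀ h ∈ P, g * h * g⁻¹ ∈ P)
    {g : Equiv.Perm α} (hg : g.IsThreeCycle) (hgP : g ∈ P) : alternatingGroup α ≤ P := by
  rw [← Equiv.Perm.closure_three_cycles_eq_alternating, Subgroup.closure_le]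
  intro h hh
  obtain ⟨π, rfl⟩ := isConj_iff.1 (Equiv.Perm.isConj_iff_cycleType_eq.2
    (hg.cycleType.trans (Equiv.Perm.IsThreeCycle.cycleType hh).symm))
  rcases Int.units_eq_one_or (Equiv.Perm.sign π) with hπ | hπ
  · exact hP π (Equiv.Perm.mem_alternatingGroup.2 hπ) g hgP
  -- An odd `π` is made even by a transposition of two points of the three-cycle. That transposition
  -- inverts `g`, so the inverse of the desired conjugate lies in `P`.
  obtain ⟨a, ha⟩ : g.support.Nonempty := by
    rw [← Finset.card_pos, hg.card_support]
    norm_num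
  have hb : g a ≠ g (g a) := fun h => Equiv.Perm.mem_support.1 ha (g.injective h.symm)
  have hg' := hg.eq_swap_mul_swap_iff_mem_support.2 ha
  have hinv : Equiv.swap (g a) (g (g a)) * g * (Equiv.swap (g a) (g (g a)))⁻¹ = g⁻¹ := by
    generalize g a = b, g (g a) = c at *
    subst hg'
    simp [mul_assoc]
  have hmem := hP (π * Equiv.swap (g a) (g (g a))) (by
    rw [Equiv.Perm.mem_alternatingGroup, Equiv.Perm.sign_mul, hπ, Equiv.Perm.sign_swap hb]
    rfl) g hgP
  rw [mul_inv_rev, show ∀ τ : Equiv.Perm α, π * τ * g * (τ⁻¹ * π⁻¹) = π * (τ * g * τ⁻¹) * π⁻¹ from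
    fun τ => by group, hinv] at hmem
  simpa [mul_assoc] using inv_mem hmem

/-! ### Primitivity and three-cycles for coprime degrees -/

namespace IsStar

section primitive

variable {E : Type*} {r s t : ℕ} {σ₀ σ₁ : Equiv.Perm E} {x : ZMod r → E}
open scoped Pointwise

/-- A block through `x 0` with a second point is shown to be stable under both generators, hence
everything by transitivity. -/
theorem isPreprimitive (hr : 1 < r) (hst : Nat.gcd s t = 1) (hne : s ≠ t)
    (h : IsStar s t σ₀ σ₁ x) :
    MulAction.IsPreprimitive (Subgroup.closure {σ₀, σ₁}) E := by
  have : Fact (1 < r) := ⟨hr⟩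
  have : NeZero r := ⟨by omega⟩
  let a : Subgroup.closure {σ₀, σ₁} := ⟨σ₀, Subgroup.subset_closure (by simp)⟩
  let c : Subgroup.closure {σ₀, σ₁} := ⟨σ₁, Subgroup.subset_closure (by simp)⟩
  have hz : ∀ (k : ℤ) (e : E), a ^ k • e = (σ₀ ^ k) e := fun _ _ => rfl
  have hc : ∀ e : E, c • e = σ₁ e := fun _ => rfl
  have htr : MulAction.IsPretransitive (Subgroup.closure {σ₀, σ₁}) E := by
    rw [MulAction.isPretransitive_iff_base (x 0)]
    intro e
    obtain ⟨i, k, rfl⟩ := h.exists_zpow e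
    refine ⟨a ^ k * c ^ i.val, ?_⟩
    have : c ^ i.val • x 0 = x i := by
      have := h.pow_apply_center 0 i.val
      rw [ZMod.natCast_zmod_val, zero_add] at this
      exact this
    rw [mul_smul, this, hz]
  refine MulAction.IsPreprimitive.of_isTrivialBlock_base (x 0) fun {B} h0 hB => ?_
  rw [MulAction.isBlock_iff_smul_eq_of_mem] at hB
  by_cases hsub : B.Subsingleton
  · exact Or.inl hsub
  right
  -- Otherwise the second point of `B` is fixed by `σ₁`, so `σ₁` preserves `B` and carries `x 0` to
  -- `x 1` inside it.
  obtain ⟨i, hi, hiB⟩ : ∃ i ≠ 0, x i ∈ B := by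
    by_contra! hcon
    refine hsub fun y hy z hz => ?_
    have : ∀ y ∈ B, y = x 0 := by
      intro y hy
      by_cases hyx : ∃ i, y = x i
      · obtain ⟨i, rfl⟩ := hyx
        by_contra hi
        exact hcon i (fun h => hi (by rw [h])) hy
      · push Not at hyx
        have hcB := hB hy (g := c) (by rw [hc, h.apply_of_ne y hyx]; exact hy)
        refine absurd ?_ (hcon 1 one_ne_zero)
        rw [← zero_add (1 : ZMod r), ← h.apply_center, ← hc, ← hcB]
        exact Set.smul_mem_smul_set h0
    rw [this y hy, this z hz]
  have hs : a ^ s ∈ MulAction.stabilizer (Subgroup.closure {σ₀, σ₁}) B := by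
    refine hB hiB ?_
    have := hz s (x i)
    rw [(h.zpow_eq_iff i i s).2 ⟨rfl, by simp [starDegree, hi]⟩, zpow_natCast] at this
    rwa [this]
  have ht : a ^ t ∈ MulAction.stabilizer (Subgroup.closure {σ₀, σ₁}) B := by
    refine hB h0 ?_
    have := hz t (x 0)
    rw [(h.zpow_eq_iff 0 0 t).2 ⟨rfl, by simp [starDegree]⟩, zpow_natCast] at this
    rwa [this]
  -- `σ₀ ^ s` fixes `x i` and `σ₀ ^ t` fixes `x 0`, so both preserve `B`; Bézout gives `σ₀` itself.
  have ha : a ∈ MulAction.stabilizer (Subgroup.closure {σ₀, σ₁}) B := by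
    have hb := Nat.gcd_eq_gcd_ab s t
    rw [hst] at hb
    have : a = (a ^ s) ^ (s.gcdA t) * (a ^ t) ^ (s.gcdB t) := by
      rw [← zpow_natCast, ← zpow_natCast, ← zpow_mul, ← zpow_mul, ← zpow_add, ← hb]
      simp
    rw [this]
    exact mul_mem (zpow_mem hs _) (zpow_mem ht _)
  have haB : ∀ y ∈ B, σ₀ y ∈ B := fun y hy => by
    have : a • B = B := ha
    rw [← this]
    exact Set.smul_mem_smul_set hy
  -- At a black vertex of degree other than one, `σ₀ (x j)` is not a central edge, so it is a point
  -- of `B` fixed by `σ₁`. Since `s ≠ t`, one of the indices `0`, `i` qualifies.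
  obtain ⟨j, hjB, hj⟩ : ∃ j, x j ∈ B ∧ starDegree s t j ≠ 1 := by
    by_cases ht1 : t = 1
    · exact ⟨i, hiB, by simp only [starDegree, hi, if_false]; omega⟩
    · exact ⟨0, h0, by simpa [starDegree] using ht1⟩
  have hcs : c ∈ MulAction.stabilizer (Subgroup.closure {σ₀, σ₁}) B := by
    refine hB (haB _ hjB) ?_
    rw [hc, h.apply_of_ne]
    · exact haB _ hjB
    · intro l hl
      have := (h.zpow_eq_iff j l 1).1 (by simpa using hl)
      exact hj (Nat.dvd_one.1 (Int.natCast_dvd_natCast.1 (by exact_mod_cast this.2)))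
  have htop : ∀ g : Subgroup.closure {σ₀, σ₁}, g • B = B := by
    have hle : Subgroup.closure {σ₀, σ₁} ≤ MulAction.stabilizer (Equiv.Perm E) B := by
      rw [Subgroup.closure_le]
      rintro g (rfl | rfl)
      · exact ha
      · exact hcs
    exact fun g => hle g.2
  refine Set.eq_univ_of_forall fun e => ?_
  obtain ⟨g, rfl⟩ := MulAction.exists_smul_eq (Subgroup.closure {σ₀, σ₁}) (x 0) e
  rw [← htop g]
  exact Set.smul_mem_smul_set h0

/-- The three-cycle is a commutator of `σ₁` with `σ₀` or with a conjugate of `σ₁`, so it lies in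
every `P` of this kind. The uniform statement serves both for the whole group and for a single
coordinate of a wreath product. -/
theorem exists_isThreeCycle [Fintype E] [DecidableEq E] (hr : 1 < r) (hst : Nat.gcd s t = 1)
    (hne : s ≠ t) (h : IsStar s t σ₀ σ₁ x) :
    ∃ g : Equiv.Perm E, g.IsThreeCycle ∧ ∀ P : Subgroup (Equiv.Perm E), σ₁ ∈ P →
      σ₀ ∈ Subgroup.normalizer (P : Set (Equiv.Perm E)) → g ∈ P := by
  have : Fact (1 < r) := ⟨hr⟩
  have : NeZero r := ⟨by omega⟩
  have hmoved : ∀ y, σ₁ y ≠ y ↔ ∃ i, y = x i := fun y => by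
    constructor
    · contrapose!
      exact h.apply_of_ne y
    · rintro ⟨i, rfl⟩ hi
      rw [h.apply_center] at hi
      simpa using h.injective hi
  -- If `s ∣ t`, then `s = 1`, and `σ₀` fixes every central edge except `x 0`. Otherwise `σ₀ ^ t`
  -- fixes `x 0` and moves every other `x i` off the center, so `σ₁` and its conjugate by `σ₀ ^ t`
  -- have only `x 0` in common support.
  by_cases hdvd : s ∣ t
  · have hs1 : s = 1 := by rwa [Nat.gcd_eq_left hdvd] at hst
    subst hs1
    refine ⟨σ₀ * σ₁ * σ₀⁻¹ * σ₁⁻¹, Equiv.Perm.isThreeCycle_commutator (a := x 0) ?_ ?_ ?_,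
      fun P hP hn =>
        mul_mem ((Subgroup.mem_normalizer_iff.1 hn _).1 hP) (inv_mem hP)⟩
    · intro h0
      have := ((h.zpow_eq_iff 0 0 1).1 (by simpa using h0)).2
      have := Nat.dvd_one.1 (Int.natCast_dvd_natCast.1 (by exact_mod_cast this))
      simp only [starDegree, if_true] at this
      omega
    · exact (hmoved _).2 ⟨0, rfl⟩
    · intro y hy
      by_cases hy1 : σ₁ y = y
      · exact Or.inr hy1
      · obtain ⟨i, rfl⟩ := (hmoved y).1 hy1
        have hi : i ≠ 0 := fun hi => hy (by rw [hi])
        left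
        simpa using (h.zpow_eq_iff i i 1).2 ⟨rfl, by simp [starDegree, hi]⟩
  · have ht0 : (σ₀ ^ t) (x 0) = x 0 := by
      simpa using (h.zpow_eq_iff 0 0 t).2 ⟨rfl, by simp [starDegree]⟩
    refine ⟨σ₁ * (σ₀ ^ t * σ₁ * (σ₀ ^ t)⁻¹) * σ₁⁻¹ * (σ₀ ^ t * σ₁ * (σ₀ ^ t)⁻¹)⁻¹,
      Equiv.Perm.isThreeCycle_commutator (a := x 0) ?_ ?_ ?_,
      fun P hP hn => ?_⟩
    · exact (hmoved _).2 ⟨0, rfl⟩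
    · intro h0
      have h1 : (σ₀ ^ t)⁻¹ (x 0) = x 0 := by rw [Equiv.Perm.inv_eq_iff_eq, ht0]
      rw [Equiv.Perm.mul_apply, Equiv.Perm.mul_apply, h1] at h0
      exact (hmoved _).2 ⟨0, rfl⟩ ((σ₀ ^ t).injective (h0.trans ht0.symm))
    · intro y hy
      by_contra! hcon
      obtain ⟨i, rfl⟩ := (hmoved y).1 hcon.1
      have h1 : σ₁ ((σ₀ ^ t)⁻¹ (x i)) ≠ (σ₀ ^ t)⁻¹ (x i) := fun h1 => hcon.2 (by
        rw [Equiv.Perm.mul_apply, Equiv.Perm.mul_apply, h1]; exact Equiv.apply_symm_apply _ _)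
      obtain ⟨j, hj⟩ := (hmoved _).1 h1
      rw [Equiv.Perm.inv_eq_iff_eq] at hj
      obtain ⟨rfl, h2⟩ := (h.zpow_eq_iff j i t).1 (by simpa using hj.symm)
      have hj0 : j ≠ 0 := fun hi => hy (by rw [hi])
      simp only [starDegree, hj0, if_false] at h2
      exact hdvd (Int.natCast_dvd_natCast.1 h2)
    · have hg := (Subgroup.mem_normalizer_iff.1 (pow_mem hn t) _).1 hP
      exact mul_mem (mul_mem (mul_mem hP hg) (inv_mem hP)) (inv_mem hg)

/-- A subgroup containing `σ₁` and normalized by `σ₀` contains the alternating group. -/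
theorem alternatingGroup_le [Fintype E] [DecidableEq E] (hr : 1 < r) (hst : Nat.gcd s t = 1)
    (hne : s ≠ t) (h : IsStar s t σ₀ σ₁ x) {P : Subgroup (Equiv.Perm E)} (hP : σ₁ ∈ P)
    (hn : σ₀ ∈ Subgroup.normalizer (P : Set (Equiv.Perm E))) : alternatingGroup E ≤ P := by
  obtain ⟨g, hg, hgP⟩ := h.exists_isThreeCycle hr hst hne
  have h₀ : σ₀ ∈ Subgroup.closure {σ₀, σ₁} := Subgroup.subset_closure (by simp)
  have h₁ : σ₁ ∈ Subgroup.closure {σ₀, σ₁} := Subgroup.subset_closure (by simp)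
  have hle : Subgroup.closure {σ₀, σ₁} ≤ Subgroup.normalizer (P : Set (Equiv.Perm E)) := by
    rw [Subgroup.closure_le]
    rintro _ (rfl | rfl)
    · exact hn
    · exact Subgroup.le_normalizer hP
  -- Jordan's theorem applies to the primitive group `⟨σ₀, σ₁⟩`, not to `P`; that group normalizes
  -- `P`, so `P` inherits all three-cycles.
  have hA : alternatingGroup E ≤ Subgroup.closure {σ₀, σ₁} :=
    Equiv.Perm.alternatingGroup_le_of_isPreprimitive_of_isThreeCycle_mem
      (h.isPreprimitive hr hst hne) hg (hgP _ h₁ (Subgroup.le_normalizer h₀))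
  exact Equiv.Perm.alternatingGroup_le_of_isThreeCycle_mem
    (fun π hπ p hp => (Subgroup.mem_normalizer_iff.1 (hle (hA hπ)) p).1 hp) hg (hgP P hP hn)

end primitive

end IsStar

/-! ### Subgroups of a wreath product generated by a shift and one factor -/

namespace RegularWreathProduct

section general

variable {D Q : Type*} [Group D] [Group Q]

/-- The inclusion of the base group of a wreath product. -/
def baseHom : (Q → D) →* D ≀ᵣ Q where
  toFun f := ⟨f, 1⟩
  map_one' := rfl
  map_mul' f g := by ext <;> simp

@[simp] theorem baseHom_left (f : Q → D) : (baseHom f).left = f := rfl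

@[simp] theorem baseHom_right (f : Q → D) : (baseHom f).right = 1 := rfl

theorem conj_baseHom (w : D ≀ᵣ Q) (f : Q → D) :
    w * baseHom f * w⁻¹ =
      baseHom (fun q => w.left q * f (w.right⁻¹ * q) * (w.left q)⁻¹) := by
  ext q
  · simp [mul_assoc]
  · simp

theorem mem_of_right_eq {H : Subgroup (D ≀ᵣ Q)} {N : Subgroup D}
    (hN : ∀ f : Q → D, (∀ q, f q ∈ N) → baseHom f ∈ H) {w x : D ≀ᵣ Q} (hw : w ∈ H)
    (hr : x.right = w.right) (hl : ∀ q, x.left q * (w.left q)⁻¹ ∈ N) : x ∈ H := by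
  have : x = baseHom (fun q => x.left q * (w.left q)⁻¹) * w := by
    ext q
    · simp
    · simp [hr]
  rw [this]
  exact mul_mem (hN _ hl) hw

end general

section cyclic

variable {D : Type*} [Group D] {d : ℕ}

/-- The element of `D ≀ᵣ ℤ_d` shifting the coordinates and applying `ρ` on wrapping around. -/
def shift (d : ℕ) (ρ : D) : D ≀ᵣ CyclicGp d := ⟨Pi.mulSingle 1 ρ, Multiplicative.ofAdd 1⟩

/-- The inclusion of the factor of the base group at coordinate `1`. -/
def factor (d : ℕ) : D →* D ≀ᵣ CyclicGp d := baseHom.comp (MonoidHom.mulSingle (fun _ => D) 1)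

theorem factor_apply (c : D) : factor d c = baseHom (Pi.mulSingle 1 c) := rfl

section action

variable {X : Type*} [MulAction D X]

theorem shift_pow_smul (ρ : D) (y : X) {j : ℕ} (hj : j < d) :
    shift d ρ ^ j • (y, (1 : CyclicGp d)) = (y, Multiplicative.ofAdd (j : ZMod d)) := by
  induction j with
  | zero => simp
  | succ j ih =>
    have h1 : Multiplicative.ofAdd (1 : ZMod d) * Multiplicative.ofAdd (j : ZMod d) =
        Multiplicative.ofAdd ((j + 1 : ℕ) : ZMod d) := by
      rw [← ofAdd_add, add_comm]
      push_cast
      rfl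
    have h2 : Multiplicative.ofAdd ((j + 1 : ℕ) : ZMod d) ≠ 1 := by
      rw [Ne, ofAdd_eq_one, ZMod.natCast_eq_zero_iff]
      exact fun h => absurd (Nat.le_of_dvd (by omega) h) (by omega)
    rw [pow_succ', mul_smul, ih (by omega), smul_def]
    simp only [shift]
    rw [h1, Pi.mulSingle_eq_of_ne h2, one_smul]

theorem shift_pow_card_smul_base [NeZero d] (ρ : D) (y : X) :
    shift d ρ ^ d • (y, (1 : CyclicGp d)) = (ρ • y, 1) := by
  have hd : d = (d - 1) + 1 := by have := NeZero.pos d; omega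
  have h1 : Multiplicative.ofAdd (1 : ZMod d) * Multiplicative.ofAdd ((d - 1 : ℕ) : ZMod d) =
      1 := by
    rw [← ofAdd_add, add_comm, ← Nat.cast_succ, Nat.succ_eq_add_one, ← hd, ZMod.natCast_self,
      ofAdd_zero]
  have h2 : shift d ρ ^ d = shift d ρ * shift d ρ ^ (d - 1) := by
    rw [← pow_succ', ← hd]
  rw [h2, mul_smul, shift_pow_smul ρ y (by omega), smul_def]
  simp only [shift]
  rw [h1, Pi.mulSingle_eq_same]

theorem exists_shift_pow_smul [NeZero d] (ρ : D) (q : CyclicGp d) :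
    ∃ j : ℕ, q = Multiplicative.ofAdd (j : ZMod d) ∧
      ∀ y : X, shift d ρ ^ j • (y, (1 : CyclicGp d)) = (y, q) := by
  refine ⟨(Multiplicative.toAdd q).val, ?_, fun y => ?_⟩
  · rw [ZMod.natCast_zmod_val, ofAdd_toAdd]
  · rw [shift_pow_smul ρ y (ZMod.val_lt _), ZMod.natCast_zmod_val, ofAdd_toAdd]

end action

theorem shift_pow_card [NeZero d] (ρ : D) : shift d ρ ^ d = baseHom fun _ => ρ := by
  refine FaithfulSMul.eq_of_smul_eq_smul (α := D × CyclicGp d) ?_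
  -- Every point is `shift d ρ ^ j • (y, 1)`, and powers of the shift commute, so the action of the
  -- `d`-th power need only be known over coordinate `1`.
  rintro ⟨y, q⟩
  obtain ⟨j, -, hj⟩ := exists_shift_pow_smul (X := D) ρ q
  rw [← hj, smul_smul, ← pow_add, add_comm, pow_add, mul_smul, shift_pow_card_smul_base, hj, hj]
  simp

theorem shift_pow_right (ρ : D) (j : ℕ) :
    (shift d ρ ^ j).right = Multiplicative.ofAdd (j : ZMod d) := by
  have := map_pow (rightHom : D ≀ᵣ CyclicGp d →* CyclicGp d) (shift d ρ) j
  rw [rightHom_eq_right] at this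
  rw [this, show (shift d ρ).right = Multiplicative.ofAdd 1 from rfl, ← ofAdd_nsmul]
  simp

theorem shift_zpow_right (ρ : D) (k : ℤ) :
    (shift d ρ ^ k).right = Multiplicative.ofAdd (k : ZMod d) := by
  have := map_zpow (rightHom : D ≀ᵣ CyclicGp d →* CyclicGp d) (shift d ρ) k
  rw [rightHom_eq_right] at this
  rw [this, show (shift d ρ).right = Multiplicative.ofAdd 1 from rfl, ← ofAdd_zsmul]
  simp

theorem conj_factor_eq [NeZero d] (ρ c : D) (q : CyclicGp d) :
    ∃ j : ℕ, shift d ρ ^ j * factor d c * (shift d ρ ^ j)⁻¹ = baseHom (Pi.mulSingle q c) := by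
  obtain ⟨j, hq, hj⟩ := exists_shift_pow_smul (X := D) ρ q
  refine ⟨j, ?_⟩
  rw [factor_apply, conj_baseHom]
  congr 1
  ext p
  rw [shift_pow_right, ← hq]
  by_cases hp : p = q
  · subst hp
    -- The coordinate of `shift d ρ ^ j` at `q` is trivial, since no wrap-around has occurred; hence
    -- `c` is transported unchanged.
    have := congrArg Prod.fst (hj 1)
    rw [smul_def] at this
    simp only [shift_pow_right, ← hq, mul_one, smul_eq_mul] at this
    simp [this]
  · have : q⁻¹ * p ≠ 1 := fun h => hp (inv_mul_eq_one.1 h).symm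
    simp [hp, this]

variable (ρ c : D)

/-- The elements of `D` occurring at coordinate `1` in the group generated by `shift d ρ` and
`factor d c`. -/
def factorSubgroup (d : ℕ) (ρ c : D) : Subgroup D :=
  (Subgroup.closure {shift d ρ, factor d c}).comap (factor d)

theorem shift_mem : shift d ρ ∈ Subgroup.closure {shift d ρ, factor d c} :=
  Subgroup.subset_closure (by simp)

theorem mem_factorSubgroup : c ∈ factorSubgroup d ρ c := Subgroup.subset_closure (by simp)

/-- Conjugation by `shift d ρ ^ d`, the diagonal `ρ`, preserves coordinate `1` and acts on it as
conjugation by `ρ`. -/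
theorem mem_normalizer_factorSubgroup [NeZero d] :
    ρ ∈ Subgroup.normalizer (factorSubgroup d ρ c : Set D) := by
  rw [Subgroup.mem_normalizer_iff]
  intro x
  have h : factor d (ρ * x * ρ⁻¹) = shift d ρ ^ d * factor d x * (shift d ρ ^ d)⁻¹ := by
    rw [shift_pow_card, factor_apply, factor_apply, conj_baseHom]
    congr 1
    ext p
    by_cases hp : p = 1
    · subst hp; simp
    · simp [hp]
  have hm := pow_mem (shift_mem (d := d) ρ c) d
  rw [factorSubgroup, Subgroup.mem_comap, Subgroup.mem_comap, h,
    Subgroup.mul_mem_cancel_right _ (inv_mem hm), Subgroup.mul_mem_cancel_left _ hm]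

/-- A base element is a product of one-coordinate elements, and powers of the shift conjugate
coordinate `1` to any other. -/
theorem baseHom_mem [NeZero d] {f : CyclicGp d → D} (hf : ∀ q, f q ∈ factorSubgroup d ρ c) :
    baseHom f ∈ Subgroup.closure {shift d ρ, factor d c} := by
  refine Subgroup.pi_mem_of_mulSingle_mem
    (H := (Subgroup.closure {shift d ρ, factor d c}).comap baseHom) f fun q => ?_
  obtain ⟨j, hj⟩ := conj_factor_eq ρ (f q) q
  have hm := pow_mem (shift_mem (d := d) ρ c) j
  rw [Subgroup.mem_comap, ← hj]
  exact mul_mem (mul_mem hm (hf q)) (inv_mem hm)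

theorem closure_eq_top [NeZero d] (h : factorSubgroup d ρ c = ⊤) :
    Subgroup.closure {shift d ρ, factor d c} = ⊤ := by
  rw [Subgroup.eq_top_iff']
  intro x
  refine mem_of_right_eq (N := ⊤) (w := shift d ρ ^ (Multiplicative.toAdd x.right).val)
    (fun f _ => baseHom_mem ρ c (by simp [h])) (pow_mem (shift_mem ρ c) _) ?_ (by simp)
  rw [shift_pow_right, ZMod.natCast_zmod_val, ofAdd_toAdd]

end cyclic

end RegularWreathProduct

/-! ### Stars inside wreath products -/

open RegularWreathProduct in
/-- A star with degrees multiplied by `d` is realized by the wreath product with `ℤ_d`. -/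
theorem IsStar.toPerm_wreath {D X : Type*} [Group D] [MulAction D X] {r s t d : ℕ} [NeZero d]
    [FaithfulSMul D X] {ρ c : D} {x : ZMod r → X}
    (h : IsStar s t (MulAction.toPerm ρ) (MulAction.toPerm c) x) :
    IsStar (d * s) (d * t) (toPerm D (CyclicGp d) X (shift d ρ))
      (toPerm D (CyclicGp d) X (factor d c)) (fun i => (x i, 1)) := by
  have hz : ∀ (k : ℤ) (p : X × CyclicGp d),
      (toPerm D (CyclicGp d) X (shift d ρ) ^ k) p = shift d ρ ^ k • p := fun k p => by
    rw [← map_zpow]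
    rfl
  have hρ : ∀ (k : ℤ) (y : X), (MulAction.toPerm ρ ^ k : Equiv.Perm X) y = ρ ^ k • y :=
    fun k y => by
      rw [← MulAction.toPermHom_apply, ← map_zpow]
      rfl
  have hdz : ∀ (k : ℤ) (y : X) (q : CyclicGp d),
      shift d ρ ^ (d * k : ℤ) • (y, q) = (ρ ^ k • y, q) := fun k y q => by
    rw [zpow_mul, zpow_natCast, shift_pow_card, ← map_zpow, smul_def]
    simp only [baseHom_left, baseHom_right, one_mul, Pi.pow_apply]
  refine ⟨fun i => ?_, ?_, ?_, fun i j k => ?_⟩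
  · have := h.apply_center i
    rw [MulAction.toPerm_apply] at this
    show factor d c • (x i, (1 : CyclicGp d)) = _
    simp [factor_apply, this]
  · rintro ⟨y, q⟩ hy
    show factor d c • (y, q) = _
    by_cases hq : q = 1
    · subst hq
      have := h.apply_of_ne y fun i hi => hy i (by rw [hi])
      rw [MulAction.toPerm_apply] at this
      simp [factor_apply, this]
    · simp [factor_apply, hq]
  · rintro ⟨y, q⟩
    obtain ⟨i, k, rfl⟩ := h.exists_zpow y
    obtain ⟨j, -, hj⟩ := exists_shift_pow_smul (X := X) ρ q
    refine ⟨i, j + d * k, ?_⟩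
    rw [hz, zpow_add, mul_smul, hdz, zpow_natCast, hj, hρ]
  · have hd : ((d : ℕ) : ℤ) ≠ 0 := by exact_mod_cast NeZero.ne d
    have hdeg : ((starDegree (d * s) (d * t) i : ℕ) : ℤ) = d * (starDegree s t i : ℕ) := by
      unfold starDegree
      split_ifs <;> push_cast <;> rfl
    rw [hz, hdeg]
    constructor
    · intro hk
      -- Returning to the fibre over `1` forces `d ∣ k`; there `shift d ρ ^ (d * l)` acts as `ρ ^
      -- l`.
      have hr : (shift d ρ ^ k).right = 1 := by
        have := congrArg Prod.snd hk
        rwa [smul_def, mul_one] at this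
      rw [shift_zpow_right, ofAdd_eq_one, ZMod.intCast_zmod_eq_zero_iff_dvd] at hr
      obtain ⟨l, rfl⟩ := hr
      rw [hdz, Prod.mk.injEq, ← hρ] at hk
      rw [mul_dvd_mul_iff_left hd]
      exact (h.zpow_eq_iff i j l).1 hk.1
    · rintro ⟨hij, l, rfl⟩
      rw [mul_assoc, hdz, ← hρ, (h.zpow_eq_iff i j _).2 ⟨hij, l, rfl⟩]

-- By rigidity the given star is conjugate to the wreath product star, and the wreath product acts
-- faithfully.
open RegularWreathProduct in
theorem IsStar.nonempty_mulEquiv {D X E : Type*} [Group D] [MulAction D X] {r s t d : ℕ}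
    [NeZero d] [FaithfulSMul D X] {ρ c : D} {x : ZMod r → X}
    (h : IsStar s t (MulAction.toPerm ρ) (MulAction.toPerm c) x) {σ₀ σ₁ : Equiv.Perm E}
    {y : ZMod r → E} (hy : IsStar (d * s) (d * t) σ₀ σ₁ y) :
    Nonempty (Subgroup.closure {σ₀, σ₁} ≃* Subgroup.closure {shift d ρ, factor d c}) := by
  obtain ⟨f, hf₀, hf₁⟩ := hy.exists_equiv (h.toPerm_wreath (d := d))
  have : Nonempty X := ⟨x 0⟩
  have h₀ : f.permCongrHom σ₀ = toPerm D (CyclicGp d) X (shift d ρ) := by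
    ext1 p
    simpa using (hf₀ (f.symm p)).symm
  have h₁ : f.permCongrHom σ₁ = toPerm D (CyclicGp d) X (factor d c) := by
    ext1 p
    simpa using (hf₁ (f.symm p)).symm
  have e₁ := (Subgroup.closure {σ₀, σ₁}).equivMapOfInjective f.permCongrHom.toMonoidHom
    f.permCongrHom.injective
  have e₂ := (Subgroup.closure {shift d ρ, factor d c}).equivMapOfInjective
    (toPerm D (CyclicGp d) X) (toPermInj _ _ _)
  have heq : (Subgroup.closure {σ₀, σ₁}).map f.permCongrHom.toMonoidHom =
      (Subgroup.closure {shift d ρ, factor d c}).map (toPerm D (CyclicGp d) X) := by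
    rw [MonoidHom.map_closure, MonoidHom.map_closure, Set.image_pair, Set.image_pair, ← h₀, ← h₁]
    rfl
  exact ⟨(e₁.trans (MulEquiv.subgroupCongr heq)).trans e₂.symm⟩

/-! ### The group of equal signs -/

section RTilde

open RegularWreathProduct Equiv.Perm

variable {m d : ℕ}

/-- `RTilde m d` surjects onto `ℤ_d`, so the index may be computed in the base group. There it is
the preimage of the two constant vectors in `{±1}^d` under the coordinatewise sign, which is onto as
`2 ≤ m`. -/
theorem RTilde_index [NeZero d] (hm : 2 ≤ m) : (RTilde m d).index = 2 ^ (d - 1) := by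
  have : Nontrivial (Fin m) := Fin.nontrivial_iff_two_le.2 hm
  let B : Subgroup (Equiv.Perm (Fin m) ≀ᵣ CyclicGp d) := rightHom.ker
  have hB : B = baseHom.range := by
    ext x
    refine ⟨fun hx => ⟨x.left, ?_⟩, ?_⟩
    · ext1
      · rfl
      · exact (show x.right = 1 from hx).symm
    · rintro ⟨f, rfl⟩
      rfl
  have h₁ : B.relIndex (RTilde m d) = B.index := by
    rw [Subgroup.relIndex_ker, Subgroup.index_ker]
    congr 2
    refine le_antisymm (Subgroup.map_le_range _ _) ?_
    rintro _ ⟨x, rfl⟩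
    exact ⟨inl x.right, fun i j => rfl, rfl⟩
  have h₂ : (RTilde m d).relIndex B = (RTilde m d).index := by
    have e₁ := Subgroup.relIndex_mul_index (inf_le_left : RTilde m d ⊓ B ≤ RTilde m d)
    have e₂ := Subgroup.relIndex_mul_index (inf_le_right : RTilde m d ⊓ B ≤ B)
    rw [Subgroup.inf_relIndex_left, h₁] at e₁
    rw [Subgroup.inf_relIndex_right, mul_comm] at e₂
    exact Nat.eq_of_mul_eq_mul_left (Nat.pos_of_ne_zero Subgroup.FiniteIndex.index_ne_zero)
      (e₂.trans e₁.symm)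
  let S : (CyclicGp d → Equiv.Perm (Fin m)) →* (CyclicGp d → ℤˣ) :=
    sign.compLeft (CyclicGp d)
  have hS : Function.Surjective S := (sign_surjective (Fin m)).comp_left
  let C : Subgroup (CyclicGp d → ℤˣ) := (Pi.constMonoidHom (CyclicGp d) ℤˣ).range
  have hC : (RTilde m d).comap baseHom = C.comap S := by
    ext f
    refine ⟨fun hf => ⟨sign (f 1), funext fun q => hf 1 q⟩, ?_⟩
    rintro ⟨u, hu⟩ i j
    exact (congrFun hu i).symm.trans (congrFun hu j)
  have hcard : Nat.card C = 2 := by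
    rw [← Nat.card_congr (MonoidHom.ofInjective (f := Pi.constMonoidHom (CyclicGp d) ℤˣ)
      Function.const_injective).toEquiv]
    simp
  have hmul := C.card_mul_index
  have hd : d = d - 1 + 1 := by have := NeZero.pos d; omega
  have hQ : Nat.card (CyclicGp d → ℤˣ) = 2 * 2 ^ (d - 1) := by
    rw [← pow_succ', ← hd]
    simp [CyclicGp]
  rw [hcard, hQ] at hmul
  rw [← h₂, hB, ← Subgroup.index_comap, hC, Subgroup.index_comap_of_surjective _ hS]
  exact Nat.eq_of_mul_eq_mul_left two_pos hmul

/-- The group generated by `shift d ρ` and `factor d c` for odd `d`, odd `ρ` and even `c`. -/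
theorem nonempty_mulEquiv_RTilde [NeZero d] (hd : Odd d) {ρ c : Equiv.Perm (Fin m)}
    (hρ : sign ρ = -1) (hc : sign c = 1)
    (hA : alternatingGroup (Fin m) ≤ factorSubgroup d ρ c) :
    Nonempty (Subgroup.closure {shift d ρ, factor d c} ≃* RTilde m d) := by
  -- The signs of `g` alternate along `0, …, d - 1`. Conjugation by `g` therefore makes each
  -- coordinate of the shift odd; at the wrap-around the sign is `sign ρ * (-1) ^ (d - 1)`, which is
  -- `-1` because `d` is odd.
  let g : CyclicGp d → Equiv.Perm (Fin m) := fun q => ρ ^ (Multiplicative.toAdd q).val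
  let ψ := MulAut.conj (baseHom g)
  have hψl : ∀ w q, sign ((ψ w).left q) =
      sign (g q) * sign (w.left q) * sign (g (w.right⁻¹ * q)) := by
    intro w q
    simp [ψ]
  have hψr : ∀ w, (ψ w).right = w.right := by simp [ψ]
  have hshift : ∀ q, sign ((ψ (shift d ρ)).left q) = -1 := by
    intro q
    have hg : ∀ q, sign (g q) = (-1) ^ (Multiplicative.toAdd q).val := fun q => by
      rw [← hρ, ← map_pow]
    have hd0 := NeZero.pos d
    rw [hψl, hg, hg]
    simp only [shift, toAdd_mul, toAdd_inv, toAdd_ofAdd]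
    by_cases hq : q = 1
    · subst hq
      have h1 : (-1 + 0 : ZMod d) = ((d - 1 : ℕ) : ZMod d) := by
        rw [Nat.cast_sub hd0, ZMod.natCast_self]
        simp
      rw [toAdd_one, h1, ZMod.val_natCast_of_lt (by omega),
        (Nat.Odd.sub_odd hd odd_one).neg_one_pow]
      simp [hρ]
    · obtain ⟨v, hv⟩ : ∃ v, (Multiplicative.toAdd q).val = v + 1 := by
        refine Nat.exists_eq_succ_of_ne_zero fun h => hq ?_
        rwa [ZMod.val_eq_zero, toAdd_eq_zero] at h
      have hv' : Multiplicative.toAdd q = ((v + 1 : ℕ) : ZMod d) := by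
        rw [← hv, ZMod.natCast_zmod_val]
      have hlt := ZMod.val_lt (Multiplicative.toAdd q)
      have h1 : -1 + Multiplicative.toAdd q = (v : ZMod d) := by
        rw [hv']
        push_cast
        ring
      rw [h1, hv, ZMod.val_natCast_of_lt (by omega), Pi.mulSingle_eq_of_ne hq, map_one, mul_one,
        pow_succ, mul_right_comm, Int.units_mul_self, one_mul]
  have hfactor : ∀ q, sign ((ψ (factor d c)).left q) = 1 := by
    intro q
    rw [hψl, factor_apply, baseHom_left, baseHom_right, inv_one, one_mul,
      mul_right_comm, Int.units_mul_self, one_mul]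
    by_cases hq : q = 1
    · subst hq; simpa using hc
    · simp [hq]
  have hle : (Subgroup.closure {shift d ρ, factor d c}).map ψ.toMonoidHom ≤ RTilde m d := by
    rw [MonoidHom.map_closure, Subgroup.closure_le, Set.image_pair]
    rintro _ (rfl | rfl)
    · exact fun i j => (hshift i).trans (hshift j).symm
    · exact fun i j => (hfactor i).trans (hfactor j).symm
  have hmem : ∀ k : ℕ, ψ (shift d ρ ^ k) ∈
      (Subgroup.closure {shift d ρ, factor d c}).map ψ.toMonoidHom := fun k =>
    Subgroup.mem_map_of_mem ψ.toMonoidHom (pow_mem (shift_mem ρ c) k)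
  have hbase : ∀ f : CyclicGp d → Equiv.Perm (Fin m), (∀ q, f q ∈ alternatingGroup (Fin m)) →
      baseHom f ∈ (Subgroup.closure {shift d ρ, factor d c}).map ψ.toMonoidHom := by
    intro f hf
    refine ⟨baseHom (g⁻¹ * f * g), baseHom_mem ρ c fun q => hA ?_, ?_⟩
    · have := mem_alternatingGroup.1 (hf q)
      simp [mem_alternatingGroup, this]
    · show baseHom g * baseHom (g⁻¹ * f * g) * (baseHom g)⁻¹ = baseHom f
      rw [← map_inv, ← map_mul, ← map_mul]
      congr 1
      group
  have hneg : ∀ q, sign ((ψ (shift d ρ ^ d)).left q) = -1 := fun q => by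
    rw [hψl, shift_pow_card, baseHom_left, baseHom_right, inv_one, one_mul, mul_right_comm,
      Int.units_mul_self, one_mul, hρ]
  have heq : (Subgroup.closure {shift d ρ, factor d c}).map ψ.toMonoidHom = RTilde m d := by
    refine le_antisymm hle fun x hx => ?_
    have hw := hmem (Multiplicative.toAdd x.right).val
    have hwr : (ψ (shift d ρ ^ (Multiplicative.toAdd x.right).val)).right = x.right := by
      rw [hψr, shift_pow_right, ZMod.natCast_zmod_val, ofAdd_toAdd]
    have hwR := hle hw
    generalize ψ (shift d ρ ^ (Multiplicative.toAdd x.right).val) = w at hw hwr hwR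
    -- If the common signs of `x` and `w` disagree, multiply `w` by the image of `shift d ρ ^ d`: it
    -- is odd in every coordinate and trivial in `ℤ_d`.
    by_cases hsign : sign (x.left 1) = sign (w.left 1)
    · refine mem_of_right_eq hbase hw hwr.symm fun q => ?_
      rw [mem_alternatingGroup, map_mul, map_inv, hx q 1, hwR q 1, hsign, mul_inv_cancel]
    · refine mem_of_right_eq hbase (mul_mem hw (hmem d)) ?_ fun q => ?_
      · rw [mul_right, hψr, shift_pow_right, ZMod.natCast_self, ofAdd_zero, mul_one, hwr]
      · rw [mem_alternatingGroup, map_mul, map_inv, hx q 1, mul_left, Pi.mul_apply, map_mul, hneg,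
          hwR q 1]
        rcases Int.units_eq_one_or (sign (x.left 1)) with h1 | h1 <;>
          rcases Int.units_eq_one_or (sign (w.left 1)) with h2 | h2 <;>
          simp_all
  exact ⟨((Subgroup.closure {shift d ρ, factor d c}).equivMapOfInjective ψ.toMonoidHom
    ψ.injective).trans (MulEquiv.subgroupCongr heq)⟩

end RTilde

/-! ### The standard star: existence of the tree -/

instance starDegree.instNeZero (s t : ℕ) [NeZero s] [NeZero t] {r : ℕ} (i : ZMod r) :
    NeZero (starDegree s t i) := by
  unfold starDegree
  split_ifs <;> infer_instance

theorem map_starDegree (s t r : ℕ) [NeZero r] :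
    (Finset.univ : Finset (ZMod r)).val.map (starDegree s t) =
      Multiset.replicate (r - 1) s + {t} := by
  rw [← Finset.insert_erase (Finset.mem_univ (0 : ZMod r)),
    Finset.insert_val_of_notMem (Finset.notMem_erase _ _), Multiset.map_cons,
    Multiset.map_congr rfl (g := fun _ => s), Multiset.map_const', Finset.card_val,
    Finset.card_erase_of_mem (Finset.mem_univ _), Finset.card_univ, ZMod.card, add_comm,
    Multiset.singleton_add]
  · simp [starDegree]
  · intro i hi
    have : i ≠ 0 := Finset.ne_of_mem_erase hi
    simp [starDegree, this]

theorem sum_starDegree (s t r : ℕ) [NeZero r] :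
    ∑ i : ZMod r, starDegree s t i = (r - 1) * s + t := by
  rw [Finset.sum_eq_multiset_sum, map_starDegree]
  simp

/-- The edges of the standard star. -/
abbrev StarEdge (r s t : ℕ) : Type := Σ i : ZMod r, ZMod (starDegree s t i)

theorem card_starEdge (r s t : ℕ) [NeZero r] [NeZero s] [NeZero t] :
    Fintype.card (StarEdge r s t) = (r - 1) * s + t := by
  rw [Fintype.card_sigma, ← sum_starDegree]
  simp only [ZMod.card]

namespace StarEdge

variable {r s t : ℕ}

/-- The rotation around the black vertices of the standard star. -/
def rotBlack (r s t : ℕ) : Equiv.Perm (StarEdge r s t) :=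
  Equiv.sigmaCongrRight fun _ => Equiv.addRight 1

/-- Translation of the index of the edges at the central white vertex. -/
def moveCenter (a : ZMod r) (e : StarEdge r s t) : StarEdge r s t :=
  if e.2 = 0 then ⟨e.1 + a, 0⟩ else e

theorem moveCenter_of_eq {a : ZMod r} {e : StarEdge r s t} (h : e.2 = 0) :
    moveCenter a e = ⟨e.1 + a, 0⟩ := if_pos h

theorem moveCenter_of_ne {a : ZMod r} {e : StarEdge r s t} (h : e.2 ≠ 0) :
    moveCenter a e = e := if_neg h

theorem moveCenter_moveCenter {a b : ZMod r} (hab : a + b = 0) (e : StarEdge r s t) :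
    moveCenter b (moveCenter a e) = e := by
  rcases e with ⟨i, y⟩
  by_cases h : y = 0
  · subst h
    rw [moveCenter_of_eq (a := a) rfl, moveCenter_of_eq rfl]
    show (⟨i + a + b, 0⟩ : StarEdge r s t) = ⟨i, 0⟩
    rw [add_assoc, hab, add_zero]
  · rw [moveCenter_of_ne (a := a) h, moveCenter_of_ne h]

/-- The rotation around the white vertices of the standard star. -/
def rotWhite (r s t : ℕ) : Equiv.Perm (StarEdge r s t) where
  toFun := moveCenter 1
  invFun := moveCenter (-1)
  left_inv := moveCenter_moveCenter (by simp)
  right_inv := moveCenter_moveCenter (by simp)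

theorem rotWhite_apply (e : StarEdge r s t) :
    rotWhite r s t e = if e.2 = 0 then ⟨e.1 + 1, 0⟩ else e := rfl

theorem rotBlack_zpow_apply (k : ℤ) (e : StarEdge r s t) :
    (rotBlack r s t ^ k) e = ⟨e.1, e.2 + k⟩ := by
  induction k using Int.induction_on with
  | zero => simp
  | succ k ih =>
    rw [add_comm, zpow_add, Equiv.Perm.mul_apply, ih]
    simp [rotBlack, add_assoc, add_comm (1 : ZMod _)]
  | pred k ih =>
    rw [sub_eq_add_neg, add_comm, zpow_add, Equiv.Perm.mul_apply, ih, zpow_neg_one,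
      Equiv.Perm.inv_eq_iff_eq]
    simp [rotBlack, add_assoc]

theorem isStar (r s t : ℕ) :
    IsStar s t (rotBlack r s t) (rotWhite r s t) (fun i => ⟨i, 0⟩) := by
  refine ⟨fun i => by simp [rotWhite_apply], ?_, ?_, fun i j k => ?_⟩
  · rintro ⟨i, y⟩ h
    have : y ≠ 0 := fun hy => h i (by rw [hy])
    simp [rotWhite_apply, this]
  · rintro ⟨i, y⟩
    obtain ⟨k, rfl⟩ := ZMod.intCast_surjective y
    exact ⟨i, k, by simp [rotBlack_zpow_apply]⟩
  · rw [rotBlack_zpow_apply, ← ZMod.intCast_zmod_eq_zero_iff_dvd]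
    constructor
    · intro h
      obtain ⟨rfl, h⟩ := Sigma.mk.inj_iff.1 h
      exact ⟨rfl, by simpa using h⟩
    · rintro ⟨rfl, h⟩
      simp [h]

end StarEdge

theorem ZMod.sign_addRight_one (k : ℕ) [NeZero k] :
    Equiv.Perm.sign (Equiv.addRight (1 : ZMod k)) = (-1) ^ (k - 1) := by
  obtain ⟨m, rfl⟩ : ∃ m, k = m + 1 := ⟨k - 1, by have := NeZero.pos k; omega⟩
  rw [← sign_finRotate]
  congr 1
  ext1 i
  exact (finRotate_apply i).symm

/-- The `s`-cycles are `r - 1` in number, an even number, so their signs cancel and only the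
`t`-cycle counts. -/
theorem StarEdge.sign_rotBlack (r s t : ℕ) [NeZero r] [NeZero s] [NeZero t] (hr : Odd r) :
    Equiv.Perm.sign (rotBlack r s t) = (-1) ^ (t - 1) := by
  have ht : t = starDegree s t (0 : ZMod r) := by simp [starDegree]
  have hs : ∀ i : {i : ZMod r // i ≠ 0}, s = starDegree s t i.1 := fun i => by
    simp [starDegree, i.2]
  let f : ZMod t ⊕ {i : ZMod r // i ≠ 0} × ZMod s → StarEdge r s t :=
    Sum.elim (fun y => ⟨0, ZMod.ringEquivCongr ht y⟩)
      fun p => ⟨p.1.1, ZMod.ringEquivCongr (hs p.1) p.2⟩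
  have hf : Function.Bijective f := by
    constructor
    · rintro (y | ⟨i, y⟩) (z | ⟨j, z⟩) h
      · simpa [f] using h
      · exact absurd (congrArg Sigma.fst h).symm j.2
      · exact absurd (congrArg Sigma.fst h) i.2
      · obtain rfl : i = j := Subtype.ext (congrArg Sigma.fst h)
        simpa [f] using h
    · rintro ⟨i, y⟩
      by_cases hi : i = 0
      · subst hi
        exact ⟨Sum.inl ((ZMod.ringEquivCongr ht).symm y), by simp [f]⟩
      · exact ⟨Sum.inr (⟨i, hi⟩, (ZMod.ringEquivCongr (hs ⟨i, hi⟩)).symm y), by simp [f]⟩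
  rw [← Equiv.Perm.sign_eq_sign_of_equiv (Equiv.Perm.sumCongr (Equiv.addRight (1 : ZMod t))
    (Equiv.prodCongrRight fun _ : {i : ZMod r // i ≠ 0} => Equiv.addRight (1 : ZMod s))) _
    (Equiv.ofBijective f hf)]
  · rw [Equiv.Perm.sign_sumCongr, Equiv.Perm.sign_prodCongrRight]
    simp only [ZMod.sign_addRight_one, Finset.prod_const, Finset.card_univ]
    have hcard : Fintype.card {i : ZMod r // i ≠ 0} = r - 1 := by
      rw [Fintype.card_subtype_compl, Fintype.card_subtype_eq, ZMod.card]
    rw [hcard, ← pow_mul, ((Nat.Odd.sub_odd hr odd_one).mul_left (s - 1)).neg_one_pow, mul_one]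
  · rintro (y | ⟨i, y⟩) <;> simp [f, StarEdge.rotBlack]

/-- The number of edges of a dessin without multiple edges. -/
theorem Dessin.card_edgeSet (D : Dessin)
    (h : ∀ e e' : D.E, D.black e = D.black e' → D.white e = D.white e' → e = e') :
    Nat.card D.graph.edgeSet = Nat.card D.E := by
  symm
  refine Nat.card_congr (Equiv.ofBijective
    (fun e => ⟨s(Sum.inl (D.black e), Sum.inr (D.white e)), ?_⟩) ⟨?_, ?_⟩)
  · exact ⟨by simp, Or.inl ⟨e, rfl, rfl⟩⟩
  · intro e e' he
    have := congrArg Subtype.val he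
    simp only [Sym2.eq_iff, Sum.inl.injEq, Sum.inr.injEq, reduceCtorEq, and_false,
      or_false] at this
    exact h e e' this.1 this.2
  · rintro ⟨p, hp⟩
    induction p using Sym2.ind with
    | _ a b =>
      have hp' : a ≠ b ∧ ((∃ e, a = Sum.inl (D.black e) ∧ b = Sum.inr (D.white e)) ∨
        ∃ e, b = Sum.inl (D.black e) ∧ a = Sum.inr (D.white e)) := hp
      obtain ⟨-, ⟨e, rfl, rfl⟩ | ⟨e, rfl, rfl⟩⟩ := hp'
      · exact ⟨e, rfl⟩
      · exact ⟨e, Subtype.ext Sym2.eq_swap⟩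

namespace StarEdge

variable {r s t : ℕ}

/-- The white endpoint of an edge of the standard star; `none` is the center. -/
def white (e : StarEdge r s t) : Option {e : StarEdge r s t // e.2 ≠ 0} :=
  if h : e.2 = 0 then none else some ⟨e, h⟩

theorem white_eq_none {e : StarEdge r s t} : white e = none ↔ e.2 = 0 := by
  unfold white
  split_ifs with h <;> simp [h]

theorem white_eq_some {e : StarEdge r s t} {e' : {e : StarEdge r s t // e.2 ≠ 0}} :
    white e = some e' ↔ e = e' := by
  unfold white
  split_ifs with h
  · simp only [false_iff]
    rintro rfl
    exact e'.2 h
  · simp [Subtype.ext_iff]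

theorem white_rotWhite (e : StarEdge r s t) : white (rotWhite r s t e) = white e := by
  rw [rotWhite_apply]
  split_ifs with h
  · rw [white_eq_none.2 h, white_eq_none]
  · rfl

theorem sameCycle_rotBlack (e e' : StarEdge r s t) :
    (rotBlack r s t).SameCycle e e' ↔ e.1 = e'.1 := by
  constructor
  · rintro ⟨k, rfl⟩
    rw [rotBlack_zpow_apply]
  · rcases e with ⟨i, y⟩
    rcases e' with ⟨j, z⟩
    rintro rfl
    obtain ⟨k, hk⟩ := ZMod.intCast_surjective (z - y)
    exact ⟨k, by simp [rotBlack_zpow_apply, hk]⟩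

theorem sameCycle_rotWhite [NeZero r] (e e' : StarEdge r s t) :
    (rotWhite r s t).SameCycle e e' ↔ white e = white e' := by
  constructor
  · rintro ⟨k, rfl⟩
    have : ∀ k : ℕ, ∀ e : StarEdge r s t, white ((rotWhite r s t ^ k) e) = white e := by
      intro k
      induction k with
      | zero => simp
      | succ k ih => intro e; rw [pow_succ', Equiv.Perm.mul_apply, white_rotWhite, ih]
    obtain ⟨k, rfl | rfl⟩ := k.eq_nat_or_neg
    · rw [zpow_natCast, this]
    · rw [zpow_neg, zpow_natCast, ← this k ((rotWhite r s t ^ k)⁻¹ e), ← Equiv.Perm.mul_apply,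
        mul_inv_cancel, Equiv.Perm.one_apply]
  · intro h
    cases hw : white e' with
    | none =>
      rw [hw, white_eq_none] at h
      rw [white_eq_none] at hw
      rcases e with ⟨i, y⟩
      rcases e' with ⟨j, z⟩
      obtain rfl : y = 0 := h
      obtain rfl : z = 0 := hw
      exact (isStar r s t).sameCycle_center i j
    | some a =>
      rw [hw, white_eq_some] at h
      rw [white_eq_some] at hw
      rw [h, hw]

theorem connected [NeZero r] :
    (bicoloredGraph (Sigma.fst : StarEdge r s t → ZMod r) white).Connected := by
  have hadj : ∀ e : StarEdge r s t,
      (bicoloredGraph (Sigma.fst : StarEdge r s t → ZMod r) white).Adj (Sum.inr (white e))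
        (Sum.inl e.1) := fun e => ⟨by simp, Or.inr ⟨e, rfl, rfl⟩⟩
  rw [SimpleGraph.connected_iff_exists_forall_reachable]
  have hB : ∀ i : ZMod r, (bicoloredGraph (Sigma.fst : StarEdge r s t → ZMod r) white).Reachable
      (Sum.inr none) (Sum.inl i) := fun i => by
    have := hadj ⟨i, 0⟩
    rw [white_eq_none.2 rfl] at this
    exact this.reachable
  refine ⟨Sum.inr none, ?_⟩
  rintro (i | _ | e)
  · exact hB i
  · rfl
  · have := hadj e.1
    rw [white_eq_some.2 rfl] at this
    exact (hB _).trans this.symm.reachable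

/-- The standard star. -/
def dessin (r s t : ℕ) [NeZero r] [NeZero s] [NeZero t] : Dessin where
  B := ZMod r
  W := Option {e : StarEdge r s t // e.2 ≠ 0}
  E := StarEdge r s t
  black := Sigma.fst
  white := white
  σ₀ := rotBlack r s t
  σ₁ := rotWhite r s t
  sameCycle_σ₀ := sameCycle_rotBlack
  sameCycle_σ₁ := sameCycle_rotWhite
  connected := connected

theorem card_snd_eq_zero [NeZero r] [NeZero s] [NeZero t] :
    Fintype.card {e : StarEdge r s t // e.2 = 0} = r := by
  conv_rhs => rw [← ZMod.card r]
  refine Fintype.card_congr ⟨fun e => e.1.1, fun i => ⟨⟨i, 0⟩, rfl⟩, ?_, fun i => rfl⟩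
  rintro ⟨⟨i, y⟩, hy⟩
  obtain rfl : y = 0 := hy
  rfl

theorem card_snd_ne_zero [NeZero r] [NeZero s] [NeZero t] :
    Fintype.card {e : StarEdge r s t // e.2 ≠ 0} = (r - 1) * (s - 1) + (t - 1) := by
  rw [Fintype.card_subtype_compl, card_snd_eq_zero, card_starEdge]
  obtain ⟨r, rfl⟩ : ∃ m, r = m + 1 := ⟨r - 1, by have := NeZero.pos r; omega⟩
  obtain ⟨s, rfl⟩ : ∃ m, s = m + 1 := ⟨s - 1, by have := NeZero.pos s; omega⟩
  obtain ⟨t, rfl⟩ : ∃ m, t = m + 1 := ⟨t - 1, by have := NeZero.pos t; omega⟩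
  simp only [Nat.add_sub_cancel, mul_add, mul_one]
  omega

variable (r s t) [NeZero r] [NeZero s] [NeZero t]

/-- Connectedness and a count: each non-central edge has its own white leaf, leaving `r` central
edges against `r` black vertices and the center. -/
theorem dessin_isTree : (dessin r s t).IsTree := by
  have hmult : ∀ e e' : (dessin r s t).E, (dessin r s t).black e = (dessin r s t).black e' →
      (dessin r s t).white e = (dessin r s t).white e' → e = e' := by
    rintro ⟨i, y⟩ ⟨j, z⟩ hb hw
    obtain rfl : i = j := hb
    change white _ = white _ at hw
    cases hz : white (⟨i, z⟩ : StarEdge r s t) with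
    | none =>
      rw [hz, white_eq_none] at hw
      rw [white_eq_none] at hz
      obtain rfl : y = 0 := hw
      obtain rfl : z = 0 := hz
      rfl
    | some a =>
      rw [hz, white_eq_some] at hw
      rw [white_eq_some] at hz
      rw [hw, hz]
  refine ⟨hmult, SimpleGraph.isTree_iff_connected_and_card.2 ⟨(dessin r s t).connected, ?_⟩⟩
  rw [Dessin.card_edgeSet _ hmult]
  show Nat.card (StarEdge r s t) + 1 =
    Nat.card (ZMod r ⊕ Option {e : StarEdge r s t // e.2 ≠ 0})
  rw [Nat.card_sum, Nat.card_eq_fintype_card, Nat.card_eq_fintype_card, Nat.card_eq_fintype_card,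
    Fintype.card_option, Fintype.card_subtype_compl, card_snd_eq_zero, ZMod.card]
  have : r ≤ Fintype.card (StarEdge r s t) := by
    conv_lhs => rw [← card_snd_eq_zero (r := r) (s := s) (t := t)]
    exact Fintype.card_subtype_le _
  omega

theorem dessin_passport : (dessin r s t).passport =
    (Multiset.replicate (r - 1) s + {t},
      {r} + Multiset.replicate ((r - 1) * (s - 1) + (t - 1)) 1) := by
  unfold Dessin.passport
  congr 1
  · rw [← map_starDegree]
    refine Multiset.map_congr rfl fun i _ => ?_
    exact (Nat.card_congr (Equiv.sigmaSubtype (β := fun i : ZMod r => ZMod (starDegree s t i))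
      i)).trans (Nat.card_zmod _)
  · show (Finset.univ : Finset (Option {e : StarEdge r s t // e.2 ≠ 0})).val.map
      (fun w => Nat.card {e : StarEdge r s t // white e = w}) = _
    have huniv : (Finset.univ : Finset (Option {e : StarEdge r s t // e.2 ≠ 0})).val =
        none ::ₘ (Finset.univ : Finset {e : StarEdge r s t // e.2 ≠ 0}).val.map some := rfl
    have hsome : ∀ w : {e : StarEdge r s t // e.2 ≠ 0},
        Nat.card {e : StarEdge r s t // white e = some w} = 1 := fun w => by
      simp only [white_eq_some]
      simp
    rw [huniv, Multiset.map_cons, Multiset.map_map, Multiset.singleton_add, ← card_snd_ne_zero,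
      ← Finset.card_univ, Finset.card_def, ← Multiset.map_const']
    simp only [white_eq_none, Nat.card_eq_fintype_card, card_snd_eq_zero]
    simp only [← Nat.card_eq_fintype_card]
    exact congrArg _ (Multiset.map_congr rfl fun w _ => hsome w)

end StarEdge

/-! ### From the passport to a star -/

/-- The case `u = v` is allowed: for `s = t` the special black vertex is an arbitrary choice. -/
theorem exists_of_map_eq_cons_replicate {α : Type*} [Fintype α] {f : α → ℕ} {u v k : ℕ}
    (h : (Finset.univ : Finset α).val.map f = u ::ₘ Multiset.replicate k v) :
    ∃ a, f a = u ∧ ∀ b ≠ a, f b = v := by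
  classical
  obtain ⟨a, -, ha⟩ := Multiset.mem_map.1 (h ▸ Multiset.mem_cons_self u _)
  refine ⟨a, ha, fun b hb => ?_⟩
  rw [← Multiset.cons_erase (Finset.mem_univ_val a), Multiset.map_cons, ha,
    Multiset.cons_inj_right] at h
  exact Multiset.eq_of_mem_replicate
    (h ▸ Multiset.mem_map_of_mem f ((Multiset.mem_erase_of_ne hb).2 (Finset.mem_univ_val b)))

theorem Equiv.Perm.zpow_apply_eq_self_iff_card_dvd {E : Type*} [Finite E] (σ : Equiv.Perm E)
    (e : E) (k : ℤ) : (σ ^ k) e = e ↔ (Nat.card {e' // σ.SameCycle e e'} : ℤ) ∣ k := by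
  have := Fintype.ofFinite E
  have hcard : Nat.card {e' // σ.SameCycle e e'} = Function.minimalPeriod (σ • ·) e := by
    classical
    rw [MulAction.minimalPeriod_eq_card, ← Nat.card_eq_fintype_card]
    refine Nat.card_congr (Equiv.subtypeEquivRight fun e' => ?_)
    constructor
    · rintro ⟨k, rfl⟩
      exact ⟨⟨σ ^ k, k, rfl⟩, rfl⟩
    · rintro ⟨⟨_, k, rfl⟩, rfl⟩
      exact ⟨k, rfl⟩
  rw [hcard, ← MulAction.zpow_smul_eq_iff_minimalPeriod_dvd, Equiv.Perm.smul_def]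

/-- An equivalence compatible with the fibres of two surjections descends to the bases. -/
theorem Equiv.exists_descend {E E' B B' : Type*} {f : E → B} {f' : E' → B'}
    (hf : Function.Surjective f) (hf' : Function.Surjective f') (F : E ≃ E')
    (h : ∀ e e', f e = f e' ↔ f' (F e) = f' (F e')) : ∃ g : B ≃ B', ∀ e, f' (F e) = g (f e) := by
  have hg : ∀ e, f' (F (Function.surjInv hf (f e))) = f' (F e) := fun e =>
    (h _ _).1 (Function.surjInv_eq hf (f e))
  refine ⟨Equiv.ofBijective (fun b => f' (F (Function.surjInv hf b))) ⟨fun b b' hb => ?_,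
    fun b' => ?_⟩, fun e => (hg e).symm⟩
  · obtain ⟨e, rfl⟩ := hf b
    obtain ⟨e', rfl⟩ := hf b'
    simp only [hg] at hb
    exact (h e e').2 hb
  · obtain ⟨e', rfl⟩ := hf' b'
    exact ⟨f (F.symm e'), by simp [hg]⟩

namespace Dessin

theorem surjective_black {D : Dessin} (h : ∀ k ∈ D.passport.1, k ≠ 0) :
    Function.Surjective D.black := fun b => by
  have hb : D.blackDegree b ≠ 0 :=
    h _ (Multiset.mem_map_of_mem D.blackDegree (Finset.mem_univ_val b))
  obtain ⟨⟨e, he⟩⟩ := (Nat.card_ne_zero.1 hb).1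
  exact ⟨e, he⟩

theorem surjective_white {D : Dessin} (h : ∀ k ∈ D.passport.2, k ≠ 0) :
    Function.Surjective D.white := fun w => by
  have hw : D.whiteDegree w ≠ 0 :=
    h _ (Multiset.mem_map_of_mem D.whiteDegree (Finset.mem_univ_val w))
  obtain ⟨⟨e, he⟩⟩ := (Nat.card_ne_zero.1 hw).1
  exact ⟨e, he⟩

/-- Dessins without isolated vertices whose pairs of rotations are conjugate are isomorphic. -/
theorem nonempty_iso {D D' : Dessin} (hb : Function.Surjective D.black)
    (hb' : Function.Surjective D'.black) (hw : Function.Surjective D.white)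
    (hw' : Function.Surjective D'.white) (F : D.E ≃ D'.E) (h₀ : ∀ e, D'.σ₀ (F e) = F (D.σ₀ e))
    (h₁ : ∀ e, D'.σ₁ (F e) = F (D.σ₁ e)) : Nonempty (D.Iso D') := by
  have key : ∀ {σ : Equiv.Perm D.E} {σ' : Equiv.Perm D'.E}, (∀ e, σ' (F e) = F (σ e)) →
      ∀ e e', σ.SameCycle e e' ↔ σ'.SameCycle (F e) (F e') := by
    intro σ σ' h e e'
    obtain rfl : σ' = F.permCongr σ := by
      ext1 p
      simpa using h (F.symm p)
    have hz : ∀ k : ℤ, F.permCongr σ ^ k = F.permCongr (σ ^ k) := fun k =>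
      (map_zpow F.permCongrHom σ k).symm
    simp [Equiv.Perm.SameCycle, hz]
  obtain ⟨β, hβ⟩ := Equiv.exists_descend hb hb' F fun e e' => by
    rw [← D.sameCycle_σ₀, ← D'.sameCycle_σ₀, key h₀]
  obtain ⟨ω, hω⟩ := Equiv.exists_descend hw hw' F fun e e' => by
    rw [← D.sameCycle_σ₁, ← D'.sameCycle_σ₁, key h₁]
  exact ⟨⟨β, ω, F, hβ, hω, h₀, h₁⟩⟩

theorem card_sameCycle_σ₀ (D : Dessin) (e : D.E) :
    Nat.card {e' // D.σ₀.SameCycle e e'} = D.blackDegree (D.black e) :=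
  Nat.card_congr (Equiv.subtypeEquivRight fun e' => by rw [D.sameCycle_σ₀, eq_comm])

theorem card_sameCycle_σ₁ (D : Dessin) (e : D.E) :
    Nat.card {e' // D.σ₁.SameCycle e e'} = D.whiteDegree (D.white e) :=
  Nat.card_congr (Equiv.subtypeEquivRight fun e' => by rw [D.sameCycle_σ₁, eq_comm])

/-- The `r` edges at the white vertex of degree `r` have distinct black ends, and there are only `r`
black vertices, so these edges represent every `σ₀`-cycle once. All other white vertices have degree
one, so `σ₁` fixes their edges. -/
theorem exists_isStar {D : Dessin} {r s t k : ℕ} (hr : 1 < r)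
    (hmult : ∀ e e' : D.E, D.black e = D.black e' → D.white e = D.white e' → e = e')
    (hP : D.passport = (Multiset.replicate (r - 1) s + {t}, {r} + Multiset.replicate k 1)) :
    ∃ x : ZMod r → D.E, IsStar s t D.σ₀ D.σ₁ x := by
  have : NeZero r := ⟨by omega⟩
  have hPb : (Finset.univ : Finset D.B).val.map D.blackDegree =
      t ::ₘ Multiset.replicate (r - 1) s := by
    rw [← Multiset.singleton_add, add_comm]
    exact congrArg Prod.fst hP
  have hPw : (Finset.univ : Finset D.W).val.map D.whiteDegree =
      r ::ₘ Multiset.replicate k 1 := by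
    rw [← Multiset.singleton_add]
    exact congrArg Prod.snd hP
  have hcardB : Nat.card D.B = r := by
    have := congrArg Multiset.card hPb
    rw [Multiset.card_map, Multiset.card_cons, Multiset.card_replicate, Finset.card_val,
      Finset.card_univ] at this
    rw [Nat.card_eq_fintype_card]
    omega
  obtain ⟨b₀, hb₀, hb⟩ := exists_of_map_eq_cons_replicate hPb
  obtain ⟨w₀, hw₀, hw⟩ := exists_of_map_eq_cons_replicate hPw
  have hbij : Function.Bijective fun e : {e : D.E // D.white e = w₀} => D.black e.1 := by
    rw [Nat.bijective_iff_injective_and_card]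
    refine ⟨fun e e' h => Subtype.ext (hmult _ _ h (e.2.trans e'.2.symm)), ?_⟩
    rw [hcardB, ← hw₀]
    rfl
  -- The numbering by powers of `σ₁` starts at the vertex of degree `t`, matching index `0` in
  -- `starDegree`.
  obtain ⟨⟨e₀, he₀⟩, hbe₀⟩ := hbij.2 b₀
  change D.black e₀ = b₀ at hbe₀
  have hper : ∀ k l : ℤ, (D.σ₁ ^ k) e₀ = (D.σ₁ ^ l) e₀ ↔ (k : ZMod r) = l := by
    intro k l
    rw [eq_comm, ← Equiv.Perm.inv_eq_iff_eq, ← Equiv.Perm.mul_apply, ← zpow_neg, ← zpow_add,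
      Equiv.Perm.zpow_apply_eq_self_iff_card_dvd, card_sameCycle_σ₁, he₀, hw₀,
      ZMod.intCast_eq_intCast_iff_dvd_sub, ← sub_eq_neg_add]
  let x : ZMod r → D.E := fun i => (D.σ₁ ^ (i.val : ℤ)) e₀
  have hval : ∀ i : ZMod r, (((i.val : ℕ) : ℤ) : ZMod r) = i := fun i => by simp
  have hxw : ∀ i, D.white (x i) = w₀ := fun i => by
    rw [← he₀, eq_comm, ← D.sameCycle_σ₁]
    exact ⟨_, rfl⟩
  have hxinj : Function.Injective x := fun i j hij => by
    rw [← hval i, ← hval j]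
    exact (hper _ _).1 hij
  have hxsurj : ∀ e, D.white e = w₀ → ∃ i, e = x i := by
    intro e he
    obtain ⟨k, rfl⟩ := (D.sameCycle_σ₁ e₀ e).2 (he₀.trans he.symm)
    exact ⟨k, (hper _ _).2 (hval _).symm⟩
  have hx0 : x 0 = e₀ := by simp [x]
  have hxb : ∀ i j, D.black (x i) = D.black (x j) → i = j := fun i j hij =>
    hxinj (hmult _ _ hij ((hxw i).trans (hxw j).symm))
  refine ⟨x, fun i => ?_, fun e he => ?_, fun e => ?_, fun i j k => ?_⟩
  · rw [show D.σ₁ (x i) = (D.σ₁ ^ (1 + (i.val : ℤ))) e₀ by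
      rw [zpow_add, zpow_one, Equiv.Perm.mul_apply]]
    rw [hper, hval]
    push_cast
    rw [ZMod.natCast_zmod_val, add_comm]
  · have hew : D.white e ≠ w₀ := fun h => by
      obtain ⟨i, hi⟩ := hxsurj e h
      exact he i hi
    have h1 := Equiv.Perm.zpow_apply_eq_self_iff_card_dvd D.σ₁ e 1
    rw [card_sameCycle_σ₁, hw _ hew] at h1
    simpa using h1
  · obtain ⟨⟨e', he'⟩, hb'⟩ := hbij.2 (D.black e)
    obtain ⟨i, rfl⟩ := hxsurj e' he'
    exact ⟨i, (D.sameCycle_σ₀ _ _).2 hb'⟩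
  · have hdeg : D.blackDegree (D.black (x i)) = starDegree s t i := by
      unfold starDegree
      split_ifs with hi
      · rw [hi, hx0, hbe₀, hb₀]
      · refine hb _ fun h => hi (hxb _ _ ?_)
        rw [h, hx0, hbe₀]
    rw [← hdeg, ← card_sameCycle_σ₀, ← Equiv.Perm.zpow_apply_eq_self_iff_card_dvd]
    constructor
    · intro h
      obtain rfl : i = j := hxb _ _ ((D.sameCycle_σ₀ _ _).1 ⟨k, h⟩)
      exact ⟨rfl, h⟩
    · rintro ⟨rfl, h⟩
      exact h

theorem monodromyGroup_eq (D : Dessin) : D.monodromyGroup = Subgroup.closure {D.σ₀, D.σ₁} := by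
  refine le_antisymm ?_ (Subgroup.closure_mono ?_)
  · rw [monodromyGroup, Subgroup.closure_le]
    have h₀ : D.σ₀ ∈ Subgroup.closure {D.σ₀, D.σ₁} := Subgroup.subset_closure (by simp)
    have h₁ : D.σ₁ ∈ Subgroup.closure {D.σ₀, D.σ₁} := Subgroup.subset_closure (by simp)
    rintro _ (rfl | rfl | rfl)
    · exact h₀
    · exact h₁
    · exact inv_mem (mul_mem h₀ h₁)
  · rintro _ (rfl | rfl) <;> simp

end Dessin

/-! ### Monodromy groups case by case -/

open RegularWreathProduct in
theorem IsStar.nonempty_mulEquiv_of_eq_top {D X E : Type*} [Group D] [MulAction D X]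
    {r s t d : ℕ} [NeZero d] [FaithfulSMul D X] {ρ c : D} {x : ZMod r → X}
    (h : IsStar s t (MulAction.toPerm ρ) (MulAction.toPerm c) x) {σ₀ σ₁ : Equiv.Perm E}
    {y : ZMod r → E} (hy : IsStar (d * s) (d * t) σ₀ σ₁ y) (htop : factorSubgroup d ρ c = ⊤) :
    Nonempty (Subgroup.closure {σ₀, σ₁} ≃* D ≀ᵣ CyclicGp d) := by
  obtain ⟨f⟩ := h.nonempty_mulEquiv hy
  exact ⟨(f.trans (MulEquiv.subgroupCongr (closure_eq_top ρ c htop))).trans Subgroup.topEquiv⟩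

/-- With all black degrees equal to one there are only central edges, permuted regularly by `ℤ_r`.
-/
theorem isStar_cyclicGp (r : ℕ) : IsStar 1 1 (MulAction.toPerm (1 : CyclicGp r))
    (MulAction.toPerm (Multiplicative.ofAdd 1 : CyclicGp r))
    (fun i : ZMod r => (Multiplicative.ofAdd i : CyclicGp r)) := by
  have h1 : MulAction.toPerm (1 : CyclicGp r) = (1 : Equiv.Perm (CyclicGp r)) := by
    ext1 p
    simp
  rw [h1]
  refine ⟨fun i => ?_, fun e he => ?_, fun e => ⟨Multiplicative.toAdd e, 0, rfl⟩, fun i j k => ?_⟩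
  · rw [MulAction.toPerm_apply, smul_eq_mul, ← ofAdd_add, add_comm]
  · exact absurd rfl (he (Multiplicative.toAdd e))
  · simp [starDegree]

theorem IsStar.nonempty_mulEquiv_cyclicGp {E : Type*} {r d : ℕ} [NeZero r] [NeZero d]
    {σ₀ σ₁ : Equiv.Perm E} {y : ZMod r → E} (hy : IsStar d d σ₀ σ₁ y) :
    Nonempty (Subgroup.closure {σ₀, σ₁} ≃* CyclicGp r ≀ᵣ CyclicGp d) := by
  refine (isStar_cyclicGp r).nonempty_mulEquiv_of_eq_top (by simpa using hy) ?_
  rw [Subgroup.eq_top_iff']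
  intro q
  have hq : q = Multiplicative.ofAdd 1 ^ (Multiplicative.toAdd q).val := by
    rw [← ofAdd_nsmul, nsmul_eq_mul, mul_one, ZMod.natCast_zmod_val, ofAdd_toAdd]
  rw [hq]
  exact pow_mem (RegularWreathProduct.mem_factorSubgroup _ _) _

theorem exists_isStar_fin {r s t m : ℕ} [NeZero r] [NeZero s] [NeZero t]
    (hm : m = (r - 1) * s + t) :
    ∃ (ρ c : Equiv.Perm (Fin m)) (x : ZMod r → Fin m), IsStar s t ρ c x ∧
      (Odd r → Equiv.Perm.sign ρ = (-1) ^ (t - 1)) := by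
  let F : StarEdge r s t ≃ Fin m := Fintype.equivFinOfCardEq ((card_starEdge r s t).trans hm.symm)
  refine ⟨_, _, _, (StarEdge.isStar r s t).permCongr F, fun hr => ?_⟩
  rw [Equiv.Perm.sign_permCongr, StarEdge.sign_rotBlack r s t hr]

section wreath

open RegularWreathProduct Equiv.Perm

variable {E : Type*} {r s t m d : ℕ} {σ₀ σ₁ : Equiv.Perm E} {y : ZMod r → E}
  {ρ c : Equiv.Perm (Fin m)} {x : ZMod r → Fin m}

theorem IsStar.nonempty_mulEquiv_perm [NeZero d] (hr : 1 < r) (hst : Nat.gcd s t = 1)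
    (hne : s ≠ t) (h : IsStar s t ρ c x) (hy : IsStar (d * s) (d * t) σ₀ σ₁ y) (hr2 : Even r) :
    Nonempty (Subgroup.closure {σ₀, σ₁} ≃* Equiv.Perm (Fin m) ≀ᵣ CyclicGp d) := by
  have : NeZero r := ⟨by omega⟩
  have hA := h.alternatingGroup_le hr hst hne (mem_factorSubgroup (d := d) ρ c)
    (mem_normalizer_factorSubgroup ρ c)
  have hc : sign c = -1 := by
    rw [h.sign_center hr, (Nat.Even.sub_odd hr.le hr2 odd_one).neg_one_pow]
  refine IsStar.nonempty_mulEquiv_of_eq_top (ρ := ρ) (c := c) h hy ?_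
  rw [Subgroup.eq_top_iff']
  intro g
  rcases Int.units_eq_one_or (sign g) with hg | hg
  · exact hA (mem_alternatingGroup.2 hg)
  · rw [← Subgroup.mul_mem_cancel_right _ (mem_factorSubgroup (d := d) ρ c)]
    refine hA (mem_alternatingGroup.2 ?_)
    rw [Equiv.Perm.sign_mul, hg, hc]
    rfl

theorem IsStar.sign_center_of_odd (hr : 1 < r) (h : IsStar s t ρ c x) (hr2 : Odd r) :
    sign c = 1 := by
  have : NeZero r := ⟨by omega⟩
  rw [h.sign_center hr, (Nat.Odd.sub_odd hr2 odd_one).neg_one_pow]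

theorem IsStar.nonempty_mulEquiv_RTilde [NeZero d] (hr : 1 < r) (hst : Nat.gcd s t = 1)
    (hne : s ≠ t) (h : IsStar s t ρ c x) (hy : IsStar (d * s) (d * t) σ₀ σ₁ y) (hr2 : Odd r)
    (hd : Odd d) (hρ : sign ρ = -1) :
    Nonempty (Subgroup.closure {σ₀, σ₁} ≃* RTilde m d) := by
  obtain ⟨f⟩ := IsStar.nonempty_mulEquiv (ρ := ρ) (c := c) h hy
  obtain ⟨g⟩ := _root_.nonempty_mulEquiv_RTilde hd hρ (h.sign_center_of_odd hr hr2)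
    (h.alternatingGroup_le hr hst hne (mem_factorSubgroup ρ c) (mem_normalizer_factorSubgroup ρ c))
  exact ⟨f.trans g⟩

/-- Both `ρ` and `c` are even, so the wreath construction runs with `D` the alternating group;
`alternatingGroup_le` is applied to the image of `factorSubgroup` in the symmetric group. -/
theorem IsStar.nonempty_mulEquiv_alternatingGroup [NeZero d] (hr : 1 < r)
    (hst : Nat.gcd s t = 1) (hne : s ≠ t) (h : IsStar s t ρ c x)
    (hy : IsStar (d * s) (d * t) σ₀ σ₁ y) (hr2 : Odd r) (hρ : sign ρ = 1) :
    Nonempty (Subgroup.closure {σ₀, σ₁} ≃* alternatingGroup (Fin m) ≀ᵣ CyclicGp d) := by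
  let ρ' : alternatingGroup (Fin m) := ⟨ρ, mem_alternatingGroup.2 hρ⟩
  let c' : alternatingGroup (Fin m) :=
    ⟨c, mem_alternatingGroup.2 (h.sign_center_of_odd hr hr2)⟩
  refine IsStar.nonempty_mulEquiv_of_eq_top (ρ := ρ') (c := c') h hy ?_
  have hA := h.alternatingGroup_le hr hst hne
    (P := (factorSubgroup d ρ' c').map (alternatingGroup (Fin m)).subtype)
    ⟨c', mem_factorSubgroup ρ' c', rfl⟩
    (Subgroup.le_normalizer_map _ ⟨ρ', mem_normalizer_factorSubgroup ρ' c', rfl⟩)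
  rw [Subgroup.eq_top_iff']
  intro g
  obtain ⟨g', hg', h'⟩ := hA g.2
  exact Subtype.ext h' ▸ hg'

end wreath

theorem mainTheorem1 (r s t : ℕ) (hr : 1 < r) (hs : 0 < s) (ht : 0 < t)
    (P : Multiset ℕ × Multiset ℕ)
    (hP : P = (Multiset.replicate (r - 1) s + {t},
      {r} + Multiset.replicate ((r - 1) * (s - 1) + (t - 1)) 1))
    (n d : ℕ) (hn : n = (r - 1) * s + t) (hd : d = Nat.gcd s t) :
    (∃ T : Dessin, T.IsTree ∧ T.passport = P) ∧
    ∀ T : Dessin, T.IsTree → T.passport = P →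
      (∀ T' : Dessin, T'.IsTree → T'.passport = P → Nonempty (T.Iso T')) ∧
      Fintype.card T.E = n ∧
      (s = t → Nonempty (T.monodromyGroup ≃* CyclicGp r ≀ᵣ CyclicGp s)) ∧
      (s ≠ t → Nat.gcd d (n / d) = 1 →
        (Even r →
          Nonempty (T.monodromyGroup ≃* Equiv.Perm (Fin (n / d)) ≀ᵣ CyclicGp d)) ∧
        (Odd r → Even (t / d) →
          (RTilde (n / d) d).index = 2 ^ (d - 1) ∧
          Nonempty (T.monodromyGroup ≃* RTilde (n / d) d)) ∧
        (Odd r → Odd (t / d) →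
          Nonempty (T.monodromyGroup ≃* alternatingGroup (Fin (n / d)) ≀ᵣ CyclicGp d))) := by
  have : NeZero r := ⟨by omega⟩
  have : NeZero s := ⟨by omega⟩
  have : NeZero t := ⟨by omega⟩
  subst hP
  refine ⟨⟨StarEdge.dessin r s t, StarEdge.dessin_isTree r s t, StarEdge.dessin_passport r s t⟩,
    fun T hT hTP => ?_⟩
  have hb : ∀ {T : Dessin}, T.passport = (Multiset.replicate (r - 1) s + {t},
      {r} + Multiset.replicate ((r - 1) * (s - 1) + (t - 1)) 1) →
      Function.Surjective T.black := fun hTP => Dessin.surjective_black fun k hk => by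
    rw [hTP, Multiset.mem_add, Multiset.mem_singleton] at hk
    rcases hk with hk | rfl
    · rw [Multiset.eq_of_mem_replicate hk]
      omega
    · omega
  have hw : ∀ {T : Dessin}, T.passport = (Multiset.replicate (r - 1) s + {t},
      {r} + Multiset.replicate ((r - 1) * (s - 1) + (t - 1)) 1) →
      Function.Surjective T.white := fun hTP => Dessin.surjective_white fun k hk => by
    rw [hTP, Multiset.mem_add, Multiset.mem_singleton] at hk
    rcases hk with rfl | hk
    · omega
    · rw [Multiset.eq_of_mem_replicate hk]
      omega
  obtain ⟨y, hy⟩ := Dessin.exists_isStar hr hT.1 hTP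
  rw [T.monodromyGroup_eq]
  refine ⟨fun T' hT' hTP' => ?_, ?_, ?_, fun hne hgcd => ?_⟩
  · obtain ⟨y', hy'⟩ := Dessin.exists_isStar hr hT'.1 hTP'
    obtain ⟨F, hF₀, hF₁⟩ := hy.exists_equiv hy'
    exact Dessin.nonempty_iso (hb hTP) (hb hTP') (hw hTP) (hw hTP') F hF₀ hF₁
  · obtain ⟨F, -, -⟩ := hy.exists_equiv (StarEdge.isStar r s t)
    rw [Fintype.card_congr F, card_starEdge, hn]
  · rintro rfl
    exact hy.nonempty_mulEquiv_cyclicGp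
  have hd0 : 0 < d := hd ▸ Nat.gcd_pos_of_pos_left t hs
  have : NeZero d := ⟨hd0.ne'⟩
  obtain ⟨s', hs'⟩ : d ∣ s := hd ▸ Nat.gcd_dvd_left s t
  obtain ⟨t', ht'⟩ : d ∣ t := hd ▸ Nat.gcd_dvd_right s t
  have hs0 : 0 < s' := Nat.pos_of_mul_pos_left (hs' ▸ hs)
  have ht0 : 0 < t' := Nat.pos_of_mul_pos_left (ht' ▸ ht)
  have : NeZero s' := ⟨hs0.ne'⟩
  have : NeZero t' := ⟨ht0.ne'⟩
  have hst : Nat.gcd s' t' = 1 := by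
    rw [hs', ht', Nat.gcd_mul_left] at hd
    exact Nat.eq_of_mul_eq_mul_left hd0 (by omega)
  have hne' : s' ≠ t' := fun h => hne (by rw [hs', ht', h])
  have hm : n / d = (r - 1) * s' + t' := by
    rw [hn, hs', ht', mul_left_comm, ← mul_add, Nat.mul_div_cancel_left _ hd0]
  have htd : t / d = t' := by rw [ht', Nat.mul_div_cancel_left _ hd0]
  rw [hs', ht'] at hy
  rw [htd]
  obtain ⟨ρ, c, x, h, hρ⟩ := exists_isStar_fin (r := r) hm
  refine ⟨fun hr2 => h.nonempty_mulEquiv_perm hr hst hne' hy hr2, fun hr2 ht2 => ⟨?_, ?_⟩,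
    fun hr2 ht2 => ?_⟩
  · refine RTilde_index ?_
    have : 1 ≤ (r - 1) * s' := Nat.mul_pos (by omega) hs0
    omega
  · refine h.nonempty_mulEquiv_RTilde hr hst hne' hy hr2 ?_ ?_
    -- For `r` odd and `t'` even, `n / d = (r - 1) * s' + t'` is even, so coprimality with `d` makes
    -- `d` odd.
    · rw [← Nat.not_even_iff_odd]
      intro hd2
      have hm2 : Even (n / d) := by
        rw [hm]
        exact ((Nat.Odd.sub_odd hr2 odd_one).mul_right s').add ht2
      have := Nat.dvd_gcd hd2.two_dvd hm2.two_dvd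
      omega
    · rw [hρ hr2, (Nat.Even.sub_odd ht0 ht2 odd_one).neg_one_pow]
  · refine h.nonempty_mulEquiv_alternatingGroup hr hst hne' hy hr2 ?_
    rw [hρ hr2, (Nat.Odd.sub_odd ht2 odd_one).neg_one_pow]
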